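/- Setting. Let $N=r^2$ be a perfect square, let $n,p\ge 1$, $m=np$, and let $A,\ell,\lambda,z_0>0$, $\omega=2\pi/\lambda$. The grid points are $(x_j,y_j)\in\{(a\ell,b\ell):a,b=1,\dots,\sqrt N\}$, $j=1,\dots,N$. The sensor coordinates $\xi_l,\eta_l$ ($l=1,\dots,n$) are uniform on $\{qA/\sqrt N: q=1,\dots,\sqrt N\}$, the probe phases $\theta_{kj}$ ($k=1,\dots,p$, $j=1,\dots,N$) are uniform on $[0,2\pi]$, and all these variables are independent. The sensing matrix $\Phi\in\mathbb C^{m\times N}$ has rows indexed by pairs (probe $k$, sensor $l$) and entries $$\phi_{(k,l),j}=\frac1{\sqrt{np}}\,e^{i\omega|x_j-\xi_l|^2/(2z_0)}\,e^{i\omega|y_j-\eta_l|^2/(2z_0)}\,e^{i\theta_{kj}}.$$ Let $\mu=\max_{i\ne j}|\Phi_j^*\Phi_i|/(\|\Phi_i\|_2\|\Phi_j\|_2)$ be its worst-case coherence ($\Phi_j$ the columns). The data are $Y=\Phi X+E$, where $E\sim CN(0,\sigma^2 I)$ with $\sigma\ge 0$ is independent of $X$. The object $X\in\mathbb R^N$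 is drawn from a generic $s$-sparse ensemble with $\|X\|_2=1$: its support $S$ is uniformly distributed among the $s$-element subsets of $\{1,\dots,N\}$, and either, given $S$ and the absolute values, the signs of the nonzero entries are independent and $\pm1$ with equal probability, or the law of $X$ is invariant under permutations of the coordinates (arbitrary values at random positions). Let $X_{\min}=\min_{i\in S}|X_i|$. One-Step Thresholding (OST) returns $\hat S=\{i:|(\Phi^*Y)_i|>\tau_*\}$ with threshold $$\tau_*=4\sqrt{\log N}\,\max\{\sigma,12\mu\sqrt2\}.$$ Theorem. Let $\delta,K>0$ and suppose that $N^2\le\frac{\delta}{2}e^{K^2/2}$, $np\ge 40K^4\log N$ and $\frac{A\ell}{\lambda z_0}=1$. Let $t>0$ and $$q=1-2\delta-4t\sqrt{\tfrac2\pi}-\frac4{\sqrt p}-\frac4{\sqrt n}-8N\exp\Big(-12t^2\sqrt{\tfrac{N-1}{np}}\Big).$$ Then OST with threshold $\tau_*$ exactly localizes $s\le\frac{m}{2\log N}$ objects satisfying $X_{\min}>2\tau_*$ with probability at least $q$, in both of the following senses. (i) There is an event for the random parameters of $\Phi$, of probability at least $q$, such that for every $\Phi$ in this event, every $\sigma\ge0$,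 every $s\le\frac m{2\log N}$ and every generic $s$-sparse ensemble with $\|X\|_2=1$ and $X_{\min}>2\tau_*$ almost surely, the probability over $(X,E)$ that $\hat S\ne S$ is at most $9/N$. (ii) For every $\sigma\ge0$, every $s\le\frac m{2\log N}$ and every generic $s$-sparse ensemble with $\|X\|_2=1$ almost surely, if $\Phi$, $X$, $E$ are independent, then with probability at least $q$ the implication "$X_{\min}>2\tau_*$ implies $\hat S=S$" holds. -/

import Mathlib

open MeasureTheory ProbabilityTheory
open scoped Matrix ENNReal

noncomputable section

/-! ### Imaging geometry and random illumination -/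

/-- Index set of the `r × r` square lattice in the object plane (`r ^ 2 = N` grid points).
The point with index `(i, j)`, counted from zero, is `((i + 1) ℓ, (j + 1) ℓ)`. -/
abbrev Grid (r : ℕ) : Type := Fin r × Fin r

/-- First coordinate of a grid point. -/
def gridX {r : ℕ} (ℓ : ℝ) (g : Grid r) : ℝ := ((g.1 : ℕ) + 1 : ℝ) * ℓ

/-- Second coordinate of a grid point. -/
def gridY {r : ℕ} (ℓ : ℝ) (g : Grid r) : ℝ := ((g.2 : ℕ) + 1 : ℝ) * ℓ

/-- The random parameters of the measurement: the probe phases `θ k j` (probe `k`, grid point `j`)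
and the sensor coordinates `(ξ l, η l)`. -/
abbrev Config (p n r : ℕ) : Type := (Fin p × Grid r → ℝ) × (Fin n → ℝ × ℝ)

/-- The discrete set `{q A / √N : q = 1, …, √N}`, where `√N = r`, of admissible values of a sensor
coordinate. -/
def sensorSet (A : ℝ) (r : ℕ) : Set ℝ := {x | ∃ q : ℕ, 1 ≤ q ∧ q ≤ r ∧ x = q * A / r}

/-- Law of the random parameters: all phases are uniform on `[0, 2π]`, all sensor coordinates are
uniform on the discrete set above, and all of these variables are independent. -/
def configLaw (p n r : ℕ) (A : ℝ) : Measure (Config p n r) :=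
  (Measure.pi fun _ : Fin p × Grid r =>
      (ProbabilityTheory.cond volume (Set.Icc 0 (2 * Real.pi)) : Measure ℝ)).prod
    (Measure.pi fun _ : Fin n =>
      (uniformOn (sensorSet A r) : Measure ℝ).prod (uniformOn (sensorSet A r)))

/-- The sensing matrix: paraxial propagation from the grid points to the sensors of the randomly
phase-modulated incident waves, with unit-norm columns. Here `lam` is the wavelength, `2π / lam`
the wavenumber, and a row is a pair (probe `k`, sensor `l`). -/
def sensingMatrix {p n r : ℕ} (ℓ lam z₀ : ℝ) (c : Config p n r) :
    Matrix (Fin p × Fin n) (Grid r) ℂ :=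
  Matrix.of fun kl j =>
    ((1 / Real.sqrt ((n : ℝ) * p) : ℝ) : ℂ)
      * Complex.exp (Complex.I *
          ((2 * Real.pi / lam * |gridX ℓ j - (c.2 kl.2).1| ^ 2 / (2 * z₀) : ℝ) : ℂ))
      * Complex.exp (Complex.I *
          ((2 * Real.pi / lam * |gridY ℓ j - (c.2 kl.2).2| ^ 2 / (2 * z₀) : ℝ) : ℂ))
      * Complex.exp (Complex.I * ((c.1 (kl.1, j) : ℝ) : ℂ))

/-! ### Coherence and One-Step Thresholding -/

section OST

variable {κ ι : Type*} [Fintype κ] [Fintype ι]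

/-- The `j`-th column of a matrix, in `ℓ²`. -/
def column (Φ : Matrix κ ι ℂ) (j : ι) : EuclideanSpace ℂ κ := WithLp.toLp 2 fun i => Φ i j

/-- Worst-case coherence: the maximum over `i ≠ j` of `|Φ_j^* Φ_i| / (‖Φ_j‖ ‖Φ_i‖)`. -/
def worstCaseCoherence (Φ : Matrix κ ι ℂ) : ℝ :=
  ⨆ q : {q : ι × ι // q.1 ≠ q.2},
    ‖inner ℂ (column Φ q.1.2) (column Φ q.1.1)‖ / (‖column Φ q.1.2‖ * ‖column Φ q.1.1‖)

/-- The threshold `τ_* = 4 √(log N) max {σ, 12 μ √2}`, where `N` is the number of columns. -/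
def ostThreshold (Φ : Matrix κ ι ℂ) (σ : ℝ) : ℝ :=
  4 * Real.sqrt (Real.log (Fintype.card ι)) * max σ (12 * worstCaseCoherence Φ * Real.sqrt 2)

/-- Noisy data `Y = Φ X + E` for a real-valued object `X`. -/
def noisyData (Φ : Matrix κ ι ℂ) (X : ι → ℝ) (E : κ → ℂ) : κ → ℂ :=
  Φ *ᵥ (fun j => (X j : ℂ)) + E

/-- Output of One-Step Thresholding: the indices at which `Z = Φ^* Y` exceeds the threshold. -/
def ostSupport (Φ : Matrix κ ι ℂ) (Y : κ → ℂ) (τ : ℝ) : Set ι := {i | τ < ‖(Φᴴ *ᵥ Y) i‖}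

/-- OST with threshold `τ_*` applied to the data `Φ X + E` returns exactly the support of `X`. -/
def OSTLocalizes (Φ : Matrix κ ι ℂ) (σ : ℝ) (X : ι → ℝ) (E : κ → ℂ) : Prop :=
  ostSupport Φ (noisyData Φ X E) (ostThreshold Φ σ) = Function.support X

/-- `X_min`, the least absolute value of the entries of `X` on its support. -/
def minStrength (X : ι → ℝ) : ℝ := ⨅ i : Function.support X, |X i|

end OST

/-! ### Random objects and noise -/

/-- The law of a random vector is a generic `s`-sparse ensemble of real-valued objects: the support
is uniformly distributed among the sets of `s` indices, and the values on it are not adapted to the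
support, in one of the two usual senses:
* given the support and the absolute values, the signs of the nonzero entries are independent and
  `±1` with equal probability (no assumption on the absolute values), or
* the (arbitrary) nonzero values are assigned to positions chosen uniformly at random (no assumption
  on the values, in particular none on the signs). -/
structure IsGenericSparse {ι : Type*} [Fintype ι] (s : ℕ) (P : Measure (ι → ℝ)) : Prop where
  card_support : ∀ᵐ x ∂P, (Function.support x).ncard = s
  uniform_support : ∀ S : Finset ι, S.card = s →
    P {x | Function.support x = (S : Set ι)} = ((Fintype.card ι).choose s : ℝ≥0∞)⁻¹
  symmetric :
    (∀ ε : ι → ℝ, (∀ i, ε i = 1 ∨ ε i = -1) → P.map (fun x i => ε i * x i) = P) ∨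
    (∀ π : Equiv.Perm ι, P.map (fun x i => x (π i)) = P)

/-- The circularly symmetric complex Gaussian law `CN(0, σ² I)`: the entries are independent, with
independent real and imaginary parts of mean `0` and variance `σ² / 2`. -/
def complexGaussianNoise (κ : Type*) [Fintype κ] (σ : ℝ) : Measure (κ → ℂ) :=
  Measure.pi fun _ : κ =>
    ((gaussianReal 0 (Real.toNNReal (σ ^ 2 / 2))).prod
      (gaussianReal 0 (Real.toNNReal (σ ^ 2 / 2)))).map fun q : ℝ × ℝ => (⟨q.1, q.2⟩ : ℂ)

/-- The lower bound for the success probability. -/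
def successBound (N n p : ℕ) (δ t : ℝ) : ℝ :=
  1 - 2 * δ - 4 * t * Real.sqrt (2 / Real.pi) - 4 / Real.sqrt p - 4 / Real.sqrt n
    - 8 * N * Real.exp (-12 * t ^ 2 * Real.sqrt (((N : ℝ) - 1) / ((n : ℝ) * p)))

end

/-!
Only two properties of the sensing matrix `Φ` matter. Write `m = np` and `L = log N`.

* All entries of `Φ` have modulus `1 / √m`, so the Welch bound holds: the worst-case coherence `μ`
  satisfies `m (N - 1) μ² ≥ N - m` (`welch_bound`), and hence `μ² ≥ 1 / (2m)` as soon as `N ≥ 2m`.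
  This is a deterministic lower bound for the threshold.
* The column sums `∑_{j ≠ i} ⟨Φ_i, Φ_j⟩` of the Gram matrix are, with high probability, at most
  `N L / m` for all `i` (`configLaw_exists_lt_norm_interference_le`). Given the sensors and the
  phases at the grid point `i`, such a sum is a linear form in the remaining independent phases, so
  Hoeffding's inequality applies with the sum of the squared coefficients as variance proxy. At the
  Rayleigh resolution `Aℓ = λz₀` the phase factors of sensors at distinct lattice points are
  orthogonal on the grid, so that only coinciding sensors contribute to this sum
  (`sum_norm_sum_star_propagator_sq_le`). There are at most `n` pairs of coinciding sensors, outside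
  an event of probability at most `n / N`, by Markov's inequality.

For a fixed `Φ` with these properties, One-Step Thresholding succeeds as soon as the filtered data
`Φᴴ Y` are within `τ_*` of the object `X` in every coordinate
(`ostLocalizes_of_forall_norm_sub_le`). The error at `i` is the sum of a Gaussian variable, at most
half of the threshold, and of the interference `∑_{j ≠ i} ⟨Φ_i, Φ_j⟩ X_j`. The latter is treated by
`measureReal_norm_sum_mul_gt_le_of_isGenericSparse`. If the signs of `X` are random, it is a
Rademacher sum. If the positions are random, its mean is controlled by the column sum, since
`|∑ X_j| ≤ √s ≤ √(m / (2L))`, and its fluctuations by a Hoeffding inequality for weighted sampling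
without replacement (`sum_perm_exp_centered_le`). That inequality is proved by pairing each index in
the support with one outside, which turns the centred sum into a Rademacher sum after an application
of Jensen's inequality.

The union bound gives failure probabilities `8 / N` for `X` and the noise, and `4 / N + n / N` for
`Φ`. The success bound of the theorem is vacuous unless `n, p > 16`, `L ≥ 5` and `N ≥ 34 m`
(`parameters_of_successBound_pos`); in this range these probabilities add up to less than
`4 / √p + 4 / √n`, and the two properties of `Φ` make the mean interference at most `μ √L`.
-/

open scoped NNReal

/-! ### Sub-Gaussian tails of complex random variables -/


section Tail

variable {Ω : Type*} [MeasurableSpace Ω] {μ : Measure Ω}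

theorem ProbabilityTheory.HasSubgaussianMGF.mono_param {X : Ω → ℝ} {c d : ℝ≥0}
    (h : HasSubgaussianMGF X c μ) (hcd : c ≤ d) : HasSubgaussianMGF X d μ :=
  ⟨h.integrable_exp_mul, fun t => (h.mgf_le t).trans (by gcongr)⟩

/-- A complex variable whose real and imaginary parts are sub-Gaussian: if its modulus exceeds `v`,
one of `±re`, `±im` is at least `v / √2`. No independence of the two parts is needed. -/
theorem measureReal_norm_gt_le_of_hasSubgaussianMGF [IsFiniteMeasure μ] {Z : Ω → ℂ} {c : ℝ≥0}
    (hre : HasSubgaussianMGF (fun ω => (Z ω).re) c μ)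
    (him : HasSubgaussianMGF (fun ω => (Z ω).im) c μ) {v : ℝ} (hv : 0 ≤ v) :
    μ.real {ω | v < ‖Z ω‖} ≤ 4 * Real.exp (-v ^ 2 / (4 * c)) := by
  have h2 : (0 : ℝ) < Real.sqrt 2 := by positivity
  have hu : 0 ≤ v / Real.sqrt 2 := by positivity
  have huv : (v / Real.sqrt 2) ^ 2 = v ^ 2 / 2 := by
    rw [div_pow, Real.sq_sqrt (by norm_num)]
  have key : ∀ {X : Ω → ℝ}, HasSubgaussianMGF X c μ →
      μ.real {ω | v / Real.sqrt 2 ≤ X ω} ≤ Real.exp (-v ^ 2 / (4 * c)) := by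
    intro X hX
    refine (hX.measure_ge_le hu).trans (le_of_eq ?_)
    rw [huv]
    congr 1
    rw [neg_div, neg_div, div_div]
    congr 2
    ring
  have hsub : {ω | v < ‖Z ω‖} ⊆
      (({ω | v / Real.sqrt 2 ≤ (Z ω).re} ∪ {ω | v / Real.sqrt 2 ≤ (-fun ω => (Z ω).re) ω}) ∪
        {ω | v / Real.sqrt 2 ≤ (Z ω).im}) ∪ {ω | v / Real.sqrt 2 ≤ (-fun ω => (Z ω).im) ω} := by
    intro ω hω
    by_contra hcon
    simp only [Set.mem_union, Set.mem_ofPred_eq, not_or, not_le, Pi.neg_apply] at hcon hω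
    obtain ⟨⟨⟨h1, h2⟩, h3⟩, h4⟩ := hcon
    have hr : (Z ω).re ^ 2 ≤ v ^ 2 / 2 := by
      rw [← huv]; exact sq_le_sq' (by linarith) h1.le
    have hi : (Z ω).im ^ 2 ≤ v ^ 2 / 2 := by
      rw [← huv]; exact sq_le_sq' (by linarith) h3.le
    have hn : ‖Z ω‖ ^ 2 = (Z ω).re ^ 2 + (Z ω).im ^ 2 := by
      rw [← Complex.normSq_eq_norm_sq, Complex.normSq_apply]; ring
    have : ‖Z ω‖ ^ 2 ≤ v ^ 2 := by rw [hn]; linarith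
    exact absurd ((pow_le_pow_iff_left₀ (norm_nonneg _) hv two_ne_zero).1 this) (not_le.2 hω)
  calc μ.real {ω | v < ‖Z ω‖} ≤ _ := measureReal_mono hsub
    _ ≤ ((μ.real _ + μ.real _) + μ.real _) + μ.real _ :=
        (measureReal_union_le _ _).trans (by
          gcongr
          exact (measureReal_union_le _ _).trans (by gcongr; exact measureReal_union_le _ _))
    _ ≤ ((Real.exp (-v ^ 2 / (4 * c)) + Real.exp (-v ^ 2 / (4 * c)))
        + Real.exp (-v ^ 2 / (4 * c))) + Real.exp (-v ^ 2 / (4 * c)) := by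
        gcongr
        · exact key hre
        · exact key hre.neg
        · exact key him
        · exact key him.neg
    _ = 4 * Real.exp (-v ^ 2 / (4 * c)) := by ring

end Tail

/-! ### Linear statistics of generic sparse vectors -/

section Generic

variable {ι : Type*} [Fintype ι]

theorem integrable_of_continuous_of_sum_sq_eq_one {P : Measure (ι → ℝ)} [IsProbabilityMeasure P]
    (hnorm : ∀ᵐ x ∂P, ∑ j, x j ^ 2 = 1) {f : (ι → ℝ) → ℝ} (hf : Continuous f) :
    Integrable f P := by
  obtain ⟨C, hC⟩ := (isCompact_closedBall (0 : ι → ℝ) 1).exists_bound_of_continuousOn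
    hf.continuousOn
  refine Integrable.of_bound hf.aestronglyMeasurable C ?_
  filter_upwards [hnorm] with x hx
  refine hC x ?_
  rw [mem_closedBall_zero_iff, pi_norm_le_iff_of_nonneg zero_le_one]
  intro i
  have : x i ^ 2 ≤ 1 := hx ▸ Finset.single_le_sum (f := fun j => x j ^ 2)
    (fun j _ => sq_nonneg _) (Finset.mem_univ i)
  rw [Real.norm_eq_abs]
  exact (sq_le_one_iff_abs_le_one _).1 this

/-- Hoeffding's inequality for a sign-symmetric random vector. The coordinates are randomized one
at a time: flipping the sign of `x j` replaces `exp (t g_j x_j)` by `cosh (t g_j x_j)`, which is at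
most `exp (t² g_j² x_j² / 2)`. -/
theorem hasSubgaussianMGF_of_sign_symmetric {P : Measure (ι → ℝ)} [IsProbabilityMeasure P]
    (hP : ∀ ε : ι → ℝ, (∀ i, ε i = 1 ∨ ε i = -1) → P.map (fun x i => ε i * x i) = P)
    (hnorm : ∀ᵐ x ∂P, ∑ j, x j ^ 2 = 1) (g : ι → ℝ) {M : ℝ≥0} (hg : ∀ j, |g j| ≤ M) :
    HasSubgaussianMGF (fun x => ∑ j, g j * x j) (M ^ 2) P := by
  classical
  refine ⟨fun t => integrable_of_continuous_of_sum_sq_eq_one hnorm (by fun_prop), fun t => ?_⟩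
  -- In `H T` the terms outside `T` are already replaced by their quadratic bounds.
  let H : Finset ι → (ι → ℝ) → ℝ := fun T x =>
    Real.exp (∑ j ∈ T, t * (g j * x j) + ∑ j ∈ Tᶜ, (t * (g j * x j)) ^ 2 / 2)
  have hHc : ∀ T, Continuous (H T) := fun T => by fun_prop
  have hHi : ∀ T, Integrable (H T) P := fun T =>
    integrable_of_continuous_of_sum_sq_eq_one hnorm (hHc T)
  have hstep : ∀ T : Finset ι, ∫ x, H T x ∂P ≤ ∫ x, H ∅ x ∂P := by
    intro T
    induction T using Finset.induction_on with
    | empty => exact le_rfl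
    | insert k T hk ih =>
      refine le_trans ?_ ih
      let ε : ι → ℝ := fun i => if i = k then -1 else 1
      have hε : P.map (fun x i => ε i * x i) = P :=
        hP ε fun i => by by_cases h : i = k <;> simp [ε, h]
      have hφ : Continuous (fun (x : ι → ℝ) i => ε i * x i) := by fun_prop
      have hflip : ∫ x, H (insert k T) x ∂P = ∫ x, H (insert k T) (fun i => ε i * x i) ∂P := by
        conv_lhs => rw [← hε]
        exact integral_map hφ.aemeasurable (hHc _).aestronglyMeasurable
      have hi2 : Integrable (fun x => H (insert k T) (fun i => ε i * x i)) P :=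
        integrable_of_continuous_of_sum_sq_eq_one hnorm ((hHc _).comp hφ)
      have hcompl : Tᶜ = insert k (insert k T)ᶜ := by
        ext j
        by_cases h : j = k <;> simp [h, hk]
      have hpt : ∀ x, H (insert k T) x + H (insert k T) (fun i => ε i * x i) ≤ 2 * H T x := by
        intro x
        let a := ∑ j ∈ T, t * (g j * x j) + ∑ j ∈ (insert k T)ᶜ, (t * (g j * x j)) ^ 2 / 2
        let b := t * (g k * x k)
        have h1 : H (insert k T) x = Real.exp (a + b) := by
          simp only [H, a, b]
          rw [Finset.sum_insert hk]; congr 1; ring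
        have h2 : H (insert k T) (fun i => ε i * x i) = Real.exp (a - b) := by
          simp only [H, a, b]
          rw [Finset.sum_insert hk]
          have e1 : ∑ j ∈ T, t * (g j * (ε j * x j)) = ∑ j ∈ T, t * (g j * x j) :=
            Finset.sum_congr rfl fun j hj => by
              have : j ≠ k := fun h => hk (h ▸ hj)
              simp [ε, this]
          have e2 : ∑ j ∈ (insert k T)ᶜ, (t * (g j * (ε j * x j))) ^ 2 / 2
              = ∑ j ∈ (insert k T)ᶜ, (t * (g j * x j)) ^ 2 / 2 :=
            Finset.sum_congr rfl fun j hj => by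
              have : j ≠ k := fun h => by simp [h] at hj
              simp [ε, this]
          rw [e1, e2]
          congr 1
          simp only [ε, if_true]
          ring
        have h3 : H T x = Real.exp (a + b ^ 2 / 2) := by
          simp only [H, a, b]
          rw [hcompl, Finset.sum_insert (by simp)]; congr 1; ring
        rw [h1, h2, h3, sub_eq_add_neg, Real.exp_add a b, Real.exp_add a (-b), Real.exp_add a]
        have := Real.cosh_le_exp_half_sq b
        rw [Real.cosh_eq] at this
        have ha := (Real.exp_pos a).le
        nlinarith
      have : 2 * ∫ x, H (insert k T) x ∂P ≤ 2 * ∫ x, H T x ∂P := by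
        rw [← integral_const_mul 2 (H T), two_mul]
        nth_rewrite 2 [hflip]
        rw [← integral_add (hHi _) hi2]
        exact integral_mono ((hHi _).add hi2) ((hHi _).const_mul 2) hpt
      linarith
  calc mgf (fun x => ∑ j, g j * x j) P t = ∫ x, H Finset.univ x ∂P := by
        simp only [mgf, H, Finset.compl_univ, Finset.sum_empty, add_zero, Finset.mul_sum]
    _ ≤ ∫ x, H ∅ x ∂P := hstep _
    _ ≤ ∫ _, Real.exp ((M ^ 2 : ℝ≥0) * t ^ 2 / 2) ∂P := by
        refine integral_mono_ae (hHi _) (integrable_const _) ?_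
        filter_upwards [hnorm] with x hx
        simp only [H, Finset.sum_empty, zero_add, Finset.compl_empty]
        refine Real.exp_le_exp.2 ?_
        calc ∑ j, (t * (g j * x j)) ^ 2 / 2 ≤ ∑ j, (M ^ 2 * t ^ 2 / 2) * x j ^ 2 := by
              refine Finset.sum_le_sum fun j _ => ?_
              have h1 : g j ^ 2 ≤ (M : ℝ) ^ 2 := sq_le_sq' (abs_le.1 (hg j)).1 (abs_le.1 (hg j)).2
              have : (t * (g j * x j)) ^ 2 / 2 = (g j ^ 2 * t ^ 2 / 2) * x j ^ 2 := by ring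
              rw [this]; gcongr
          _ = _ := by rw [← Finset.mul_sum, hx]; push_cast; ring
    _ = _ := by simp

/-- If `k ↦ e k` pairs each index of `S` with a private partner outside `S`, then the differences
`g (π k) - g (π (e k))`, for a uniformly random permutation `π`, are exchangeable under independent
sign changes, because composing `π` with the transposition of `k` and `e k` flips the `k`-th
difference and fixes the others. -/
theorem sum_perm_exp_sum_sub_le [DecidableEq ι] {g : ι → ℝ} {M : ℝ} (hg : ∀ j, |g j| ≤ M)
    {S : Finset ι} {e : ι → ι} (he : ∀ k ∈ S, e k ∉ S) (hinj : Set.InjOn e S) (w : ι → ℝ) (t : ℝ)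
    {T : Finset ι} (hT : T ⊆ S) :
    ∑ π : Equiv.Perm ι, Real.exp (t * ∑ k ∈ T, w k * (g (π k) - g (π (e k))))
      ≤ Fintype.card (Equiv.Perm ι) * Real.exp (2 * t ^ 2 * M ^ 2 * ∑ k ∈ T, w k ^ 2) := by
  induction T using Finset.induction_on with
  | empty => simp
  | insert k T hk ih =>
    have hTS : T ⊆ S := (Finset.subset_insert k T).trans hT
    have hkS : k ∈ S := hT (Finset.mem_insert_self k T)
    let F : Equiv.Perm ι → ℝ := fun π => ∑ k ∈ T, w k * (g (π k) - g (π (e k)))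
    let D : Equiv.Perm ι → ℝ := fun π => w k * (g (π k) - g (π (e k)))
    let ρ : Equiv.Perm ι := Equiv.swap k (e k)
    have hF : ∀ π, F (π * ρ) = F π := by
      intro π
      refine Finset.sum_congr rfl fun j hj => ?_
      have hjS := hTS hj
      have hjk : j ≠ k := fun h => hk (h ▸ hj)
      have h1 : ρ j = j := Equiv.swap_apply_of_ne_of_ne hjk fun h => he k hkS (h ▸ hjS)
      have h2 : ρ (e j) = e j := Equiv.swap_apply_of_ne_of_ne
        (fun h => he j hjS (h ▸ hkS)) fun h => hjk (hinj hjS hkS h)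
      rw [Equiv.Perm.mul_apply, Equiv.Perm.mul_apply, h1, h2]
    have hD : ∀ π, D (π * ρ) = -D π := by
      intro π
      simp only [D, ρ, Equiv.Perm.mul_apply, Equiv.swap_apply_left, Equiv.swap_apply_right]
      ring
    have hDb : ∀ π, D π ^ 2 ≤ 4 * M ^ 2 * w k ^ 2 := by
      intro π
      have h1 := abs_le.1 (hg (π k))
      have h2 := abs_le.1 (hg (π (e k)))
      have : (g (π k) - g (π (e k))) ^ 2 ≤ (2 * M) ^ 2 := sq_le_sq' (by linarith) (by linarith)
      have e1 : D π ^ 2 = (g (π k) - g (π (e k))) ^ 2 * w k ^ 2 := by simp only [D]; ring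
      rw [e1]
      have := mul_le_mul_of_nonneg_right this (sq_nonneg (w k))
      linarith
    have hsplit : ∀ π : Equiv.Perm ι,
        Real.exp (t * ∑ k ∈ insert k T, w k * (g (π k) - g (π (e k))))
          = Real.exp (t * F π) * Real.exp (t * D π) := by
      intro π
      rw [Finset.sum_insert hk, ← Real.exp_add]; congr 1; simp only [F, D]; ring
    simp only [hsplit]
    have hflip : ∑ π, Real.exp (t * F π) * Real.exp (t * D π)
        = ∑ π, Real.exp (t * F π) * Real.exp (-(t * D π)) := by
      rw [← Equiv.sum_comp (Equiv.mulRight ρ)]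
      refine Finset.sum_congr rfl fun π _ => ?_
      rw [Equiv.coe_mulRight, hF, hD, mul_neg]
    calc ∑ π, Real.exp (t * F π) * Real.exp (t * D π)
        = ∑ π, Real.exp (t * F π) * Real.cosh (t * D π) := by
          have : ∑ π, Real.exp (t * F π) * Real.cosh (t * D π)
              = (∑ π, Real.exp (t * F π) * Real.exp (t * D π)
                + ∑ π, Real.exp (t * F π) * Real.exp (-(t * D π))) / 2 := by
            rw [← Finset.sum_add_distrib, Finset.sum_div]
            refine Finset.sum_congr rfl fun π _ => ?_
            rw [Real.cosh_eq]; ring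
          rw [this, ← hflip]; ring
      _ ≤ ∑ π, Real.exp (t * F π) * Real.exp (2 * t ^ 2 * M ^ 2 * w k ^ 2) := by
          refine Finset.sum_le_sum fun π _ => ?_
          gcongr
          refine (Real.cosh_le_exp_half_sq _).trans (Real.exp_le_exp.2 ?_)
          have := mul_le_mul_of_nonneg_left (hDb π) (sq_nonneg t)
          rw [mul_pow]; linarith
      _ ≤ Fintype.card (Equiv.Perm ι) * Real.exp (2 * t ^ 2 * M ^ 2 * ∑ k ∈ T, w k ^ 2)
            * Real.exp (2 * t ^ 2 * M ^ 2 * w k ^ 2) := by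
          rw [← Finset.sum_mul]
          gcongr
          exact ih hTS
      _ = _ := by
          rw [mul_assoc, ← Real.exp_add, Finset.sum_insert hk]; congr 2; ring

/-- Hoeffding's inequality for sampling without replacement, with weights supported
on at most half of the indices. Averaging the differences of `sum_perm_exp_sum_sub_le` over all
cyclic shifts of the partners turns the partner terms into the mean of `g` off the support of `x`;
with the weights `x k - (∑ j, x j) / N` on the support this yields the centred sum, so Jensen's
inequality reduces the claim to that lemma. -/
theorem sum_perm_exp_centered_le [DecidableEq ι] [Nonempty ι] {g : ι → ℝ} {M : ℝ}
    (hg : ∀ j, |g j| ≤ M) (x : ι → ℝ)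
    (hs : 2 * (Finset.univ.filter fun j => x j ≠ 0).card ≤ Fintype.card ι) (t : ℝ) :
    ∑ π : Equiv.Perm ι,
        Real.exp (t * (∑ j, g j * x (π j) - (∑ j, x j) * (∑ j, g j) / Fintype.card ι))
      ≤ Fintype.card (Equiv.Perm ι) * Real.exp (2 * t ^ 2 * M ^ 2 * ∑ j, x j ^ 2) := by
  set S : Finset ι := Finset.univ.filter fun j => x j ≠ 0 with hS
  have hcard : S.card + Sᶜ.card = Fintype.card ι := Finset.card_add_card_compl S
  have hN : 0 < Fintype.card ι := Fintype.card_pos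
  have hm : 0 < Sᶜ.card := by omega
  have : NeZero Sᶜ.card := ⟨hm.ne'⟩
  have hN' : (0 : ℝ) < Fintype.card ι := by exact_mod_cast hN
  have hm' : (0 : ℝ) < Sᶜ.card := by exact_mod_cast hm
  have hcard' : (S.card : ℝ) + Sᶜ.card = Fintype.card ι := by exact_mod_cast hcard
  let a : ℝ := (∑ j, x j) / Fintype.card ι
  let w : ι → ℝ := fun k => x k - a
  -- Partners of the indices of `S` outside `S`, and their cyclic shifts `e c`.
  obtain ⟨e₀⟩ : Nonempty (S ↪ (Sᶜ : Finset ι)) :=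
    Function.Embedding.nonempty_of_card_le (by simp only [Fintype.card_coe]; omega)
  let φ : (Sᶜ : Finset ι) ≃ Fin Sᶜ.card := Finset.equivFin _
  let e : Fin Sᶜ.card → ι → ι := fun c k =>
    if h : k ∈ S then (φ.symm (c + φ (e₀ ⟨k, h⟩)) : ι) else k
  have he : ∀ c, ∀ k ∈ S, e c k ∉ S := by
    intro c k hk
    simp only [e, hk, dif_pos]
    exact Finset.mem_compl.1 (Subtype.coe_prop _)
  have hinj : ∀ c, Set.InjOn (e c) S := by
    intro c k hk l hl hkl
    have hk' : k ∈ S := hk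
    have hl' : l ∈ S := hl
    simp only [e, hk', hl', dif_pos] at hkl
    have := e₀.injective (φ.injective (add_left_cancel (φ.symm.injective (Subtype.ext hkl))))
    simpa using this
  have hxS : ∀ j ∈ Sᶜ, x j = 0 := fun j hj => by simpa [hS] using hj
  have hsumS : ∀ f : ι → ℝ, ∑ j, f j * x j = ∑ j ∈ S, f j * x j := fun f =>
    (Finset.sum_subset (Finset.subset_univ S) fun j _ hj => by
      rw [hxS j (Finset.mem_compl.2 hj), mul_zero]).symm
  have hsumx : ∑ j, x j = ∑ j ∈ S, x j := by simpa using hsumS fun _ => 1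
  have hw : ∑ k ∈ S, w k = a * Sᶜ.card := by
    simp only [w, Finset.sum_sub_distrib, Finset.sum_const, nsmul_eq_mul]
    rw [← hsumx]
    have : ∑ j, x j = a * Fintype.card ι := by simp only [a]; field_simp
    rw [this, ← hcard']; ring
  have hw2 : ∑ k ∈ S, w k ^ 2 ≤ ∑ j, x j ^ 2 := by
    have h1 : ∑ k ∈ S, w k ^ 2 ≤ ∑ k, w k ^ 2 :=
      Finset.sum_le_sum_of_subset_of_nonneg (Finset.subset_univ _) fun _ _ _ => sq_nonneg _
    have h2 : ∑ k, w k ^ 2 = ∑ j, x j ^ 2 - Fintype.card ι * a ^ 2 := by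
      have : ∑ j, x j = a * Fintype.card ι := by simp only [a]; field_simp
      simp only [w, sub_sq, Finset.sum_add_distrib, Finset.sum_sub_distrib, Finset.sum_const,
        ← Finset.sum_mul, ← Finset.mul_sum, this, nsmul_eq_mul, Finset.card_univ]
      ring
    have := mul_nonneg hN'.le (sq_nonneg a)
    linarith
  let Y : Fin Sᶜ.card → Equiv.Perm ι → ℝ := fun c π =>
    ∑ k ∈ S, w k * (g (π k) - g (π (e c k)))
  have hY : ∀ π : Equiv.Perm ι, ∑ c, Y c π
      = Sᶜ.card * (∑ j, g (π j) * x j - (∑ j, x j) * (∑ j, g j) / Fintype.card ι) := by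
    intro π
    have h1 : ∀ k ∈ S, ∑ c, g (π (e c k)) = ∑ j ∈ Sᶜ, g (π j) := by
      intro k hk
      simp only [e, hk, dif_pos]
      refine (Equiv.sum_comp (Equiv.addRight (φ (e₀ ⟨k, hk⟩)))
        fun c => g (π (φ.symm c : ι))).trans ?_
      rw [φ.symm.sum_comp fun y => g (π (y : ι)), Finset.sum_coe_sort Sᶜ fun y => g (π y)]
    have h2 : ∑ j ∈ Sᶜ, g (π j) = ∑ j, g j - ∑ j ∈ S, g (π j) := by
      rw [← Equiv.sum_comp π g, ← Finset.sum_add_sum_compl S fun j => g (π j)]; ring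
    have h3 : ∑ c, Y c π = ∑ k ∈ S, w k * (Sᶜ.card * g (π k) - ∑ j ∈ Sᶜ, g (π j)) := by
      simp only [Y]
      rw [Finset.sum_comm]
      refine Finset.sum_congr rfl fun k hk => ?_
      rw [← Finset.mul_sum, Finset.sum_sub_distrib, h1 k hk]
      simp
    have h4 : ∑ k ∈ S, w k * g (π k) = ∑ j, g (π j) * x j - a * ∑ k ∈ S, g (π k) := by
      rw [hsumS, Finset.mul_sum, ← Finset.sum_sub_distrib]
      exact Finset.sum_congr rfl fun k _ => by simp only [w]; ring
    have h5 : ∑ k ∈ S, w k * (Sᶜ.card * g (π k) - ∑ j ∈ Sᶜ, g (π j))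
        = Sᶜ.card * (∑ k ∈ S, w k * g (π k)) - (∑ k ∈ S, w k) * ∑ j ∈ Sᶜ, g (π j) := by
      rw [Finset.mul_sum, Finset.sum_mul, ← Finset.sum_sub_distrib]
      exact Finset.sum_congr rfl fun k _ => by ring
    rw [h3, h5, hw, h4, h2]
    simp only [a]
    ring
  -- The averaged differences `Y c π` give back the centred sum, so Jensen applies to `exp`.
  have hJensen : ∀ π : Equiv.Perm ι,
      Real.exp (t * (∑ j, g (π j) * x j - (∑ j, x j) * (∑ j, g j) / Fintype.card ι))
        ≤ ∑ c, (Sᶜ.card : ℝ)⁻¹ * Real.exp (t * Y c π) := by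
    intro π
    have := convexOn_exp.map_sum_le (t := Finset.univ) (w := fun _ : Fin Sᶜ.card => (Sᶜ.card : ℝ)⁻¹)
      (p := fun c => t * Y c π) (fun _ _ => by positivity) (by simp [hm'.ne'])
      (fun _ _ => Set.mem_univ _)
    simp only [smul_eq_mul] at this
    refine le_trans (le_of_eq ?_) this
    rw [← Finset.mul_sum, ← Finset.mul_sum, hY]
    congr 1
    field_simp
  calc ∑ π : Equiv.Perm ι,
        Real.exp (t * (∑ j, g j * x (π j) - (∑ j, x j) * (∑ j, g j) / Fintype.card ι))
      = ∑ π : Equiv.Perm ι,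
        Real.exp (t * (∑ j, g (π j) * x j - (∑ j, x j) * (∑ j, g j) / Fintype.card ι)) := by
        rw [← Equiv.sum_comp (Equiv.inv (Equiv.Perm ι))]
        refine Finset.sum_congr rfl fun π _ => ?_
        rw [← Equiv.sum_comp π fun j => g j * x ((Equiv.inv (Equiv.Perm ι)) π j)]
        simp
    _ ≤ ∑ π : Equiv.Perm ι, ∑ c, (Sᶜ.card : ℝ)⁻¹ * Real.exp (t * Y c π) :=
        Finset.sum_le_sum fun π _ => hJensen π
    _ = ∑ c, (Sᶜ.card : ℝ)⁻¹ * ∑ π : Equiv.Perm ι, Real.exp (t * Y c π) := by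
        rw [Finset.sum_comm]; simp only [Finset.mul_sum]
    _ ≤ ∑ _c : Fin Sᶜ.card, (Sᶜ.card : ℝ)⁻¹ *
          (Fintype.card (Equiv.Perm ι) * Real.exp (2 * t ^ 2 * M ^ 2 * ∑ k ∈ S, w k ^ 2)) := by
        gcongr with c
        exact sum_perm_exp_sum_sub_le hg (he c) (hinj c) w t subset_rfl
    _ = Fintype.card (Equiv.Perm ι) * Real.exp (2 * t ^ 2 * M ^ 2 * ∑ k ∈ S, w k ^ 2) := by
        rw [Finset.sum_const, Finset.card_univ, Fintype.card_fin, nsmul_eq_mul]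
        field_simp
    _ ≤ _ := by gcongr

theorem hasSubgaussianMGF_of_perm_invariant [Nonempty ι] {P : Measure (ι → ℝ)}
    [IsProbabilityMeasure P] (hP : ∀ π : Equiv.Perm ι, P.map (fun x i => x (π i)) = P)
    (hnorm : ∀ᵐ x ∂P, ∑ j, x j ^ 2 = 1)
    (hs : ∀ᵐ x ∂P, 2 * (Function.support x).ncard ≤ Fintype.card ι)
    (g : ι → ℝ) {M : ℝ≥0} (hg : ∀ j, |g j| ≤ M) :
    HasSubgaussianMGF (fun x => ∑ j, g j * x j - (∑ j, x j) * (∑ j, g j) / Fintype.card ι)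
      (4 * M ^ 2) P := by
  classical
  refine ⟨fun t => integrable_of_continuous_of_sum_sq_eq_one hnorm (by fun_prop), fun t => ?_⟩
  let H : (ι → ℝ) → ℝ := fun x =>
    Real.exp (t * (∑ j, g j * x j - (∑ j, x j) * (∑ j, g j) / Fintype.card ι))
  have hHc : Continuous H := by fun_prop
  have hφ : ∀ π : Equiv.Perm ι, Continuous fun (x : ι → ℝ) i => x (π i) := fun π => by fun_prop
  have hHi : ∀ π : Equiv.Perm ι, Integrable (fun x : ι → ℝ => H fun i => x (π i)) P := fun π =>
    integrable_of_continuous_of_sum_sq_eq_one hnorm (hHc.comp (hφ π))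
  have hinv : ∀ π : Equiv.Perm ι, ∫ x, H x ∂P = ∫ x, H (fun i => x (π i)) ∂P := by
    intro π
    conv_lhs => rw [← hP π]
    exact integral_map (hφ π).aemeasurable hHc.aestronglyMeasurable
  have hcard : (0 : ℝ) < Fintype.card (Equiv.Perm ι) := by exact_mod_cast Fintype.card_pos
  have hsum : Fintype.card (Equiv.Perm ι) * ∫ x, H x ∂P
      = ∫ x, ∑ π : Equiv.Perm ι, H (fun i => x (π i)) ∂P := by
    rw [integral_finsetSum _ fun π _ => hHi π, Finset.sum_congr rfl fun π _ => (hinv π).symm]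
    simp
  have hle : ∫ x, ∑ π : Equiv.Perm ι, H (fun i => x (π i)) ∂P
      ≤ ∫ _, Fintype.card (Equiv.Perm ι) * Real.exp ((4 * M ^ 2 : ℝ≥0) * t ^ 2 / 2) ∂P := by
    refine integral_mono_ae (integrable_finsetSum _ fun π _ => hHi π) (integrable_const _) ?_
    filter_upwards [hnorm, hs] with x hx hsx
    have hsupp : (Finset.univ.filter fun j => x j ≠ 0).card = (Function.support x).ncard := by
      rw [← Set.ncard_coe_finset]; congr 1; ext j; simp
    have h := sum_perm_exp_centered_le hg x (by rw [hsupp]; exact hsx) t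
    rw [hx] at h
    simp only [H]
    have hx' : ∀ π : Equiv.Perm ι, ∑ j, x (π j) = ∑ j, x j := fun π => Equiv.sum_comp π x
    simp only [hx']
    refine h.trans (le_of_eq ?_)
    push_cast
    congr 2
    ring
  rw [← hsum] at hle
  simp only [integral_const, probReal_univ, one_smul] at hle
  exact le_of_mul_le_mul_left hle hcard

/-- A linear statistic of a generic `s`-sparse unit vector with `2 s ≤ N` concentrates: the
random-sign model gives a centred statistic, and in the random-position model its mean is at most
`√s ‖∑ g‖ / N`. -/
theorem measureReal_norm_sum_mul_gt_le_of_isGenericSparse [Nonempty ι] {P : Measure (ι → ℝ)}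
    [IsProbabilityMeasure P] {s : ℕ} (hP : IsGenericSparse s P)
    (hnorm : ∀ᵐ x ∂P, ∑ j, x j ^ 2 = 1) (hs : 2 * s ≤ Fintype.card ι)
    (g : ι → ℂ) {M : ℝ≥0} (hg : ∀ j, ‖g j‖ ≤ M) {v : ℝ} (hv : 0 ≤ v) :
    P.real {x | Real.sqrt s * ‖∑ j, g j‖ / Fintype.card ι + v < ‖∑ j, g j * (x j : ℂ)‖}
      ≤ 4 * Real.exp (-v ^ 2 / (16 * M ^ 2)) := by
  have hre : ∀ j, |(g j).re| ≤ M := fun j => (Complex.abs_re_le_norm _).trans (hg j)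
  have him : ∀ j, |(g j).im| ≤ M := fun j => (Complex.abs_im_le_norm _).trans (hg j)
  have hexp : 4 * Real.exp (-v ^ 2 / (4 * (4 * M ^ 2 : ℝ≥0)))
      = 4 * Real.exp (-v ^ 2 / (16 * M ^ 2)) := by
    push_cast; congr 3; ring
  rw [← hexp]
  rcases hP.symmetric with hsym | hperm
  · refine le_trans (measureReal_mono ?_) (measureReal_norm_gt_le_of_hasSubgaussianMGF
      (μ := P) (Z := fun x => ∑ j, g j * (x j : ℂ)) (c := 4 * M ^ 2) ?_ ?_ hv)
    · intro x hx
      have hx : Real.sqrt s * ‖∑ j, g j‖ / Fintype.card ι + v < ‖∑ j, g j * (x j : ℂ)‖ := hx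
      refine lt_of_le_of_lt ?_ hx
      have : 0 ≤ Real.sqrt s * ‖∑ j, g j‖ / Fintype.card ι := by positivity
      linarith
    · have := HasSubgaussianMGF.mono_param (hasSubgaussianMGF_of_sign_symmetric hsym hnorm _ hre)
        (show M ^ 2 ≤ 4 * M ^ 2 from le_mul_of_one_le_left (zero_le) (by norm_num))
      simpa [Complex.re_sum] using this
    · have := HasSubgaussianMGF.mono_param (hasSubgaussianMGF_of_sign_symmetric hsym hnorm _ him)
        (show M ^ 2 ≤ 4 * M ^ 2 from le_mul_of_one_le_left (zero_le) (by norm_num))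
      simpa [Complex.im_sum] using this
  · have hcs : ∀ᵐ x ∂P, |∑ j, x j| ≤ Real.sqrt s := by
      filter_upwards [hP.card_support, hnorm] with x hx hx1
      classical
      have hsupp : (Finset.univ.filter fun j => x j ≠ 0).card = (Function.support x).ncard := by
        rw [← Set.ncard_coe_finset]; congr 1; ext j; simp
      have h1 : ∑ j, x j = ∑ j ∈ Finset.univ.filter (fun j => x j ≠ 0), x j :=
        (Finset.sum_filter_ne_zero _).symm
      have h2 := sq_sum_le_card_mul_sum_sq (s := Finset.univ.filter fun j => x j ≠ 0) (f := x)
      rw [← h1, hsupp, hx] at h2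
      have h3 : ∑ j ∈ Finset.univ.filter (fun j => x j ≠ 0), x j ^ 2 ≤ 1 := by
        rw [← hx1]
        exact Finset.sum_le_sum_of_subset_of_nonneg (Finset.subset_univ _)
          fun _ _ _ => sq_nonneg _
      refine Real.abs_le_sqrt (h2.trans ?_)
      exact mul_le_of_le_one_right (Nat.cast_nonneg _) h3
    have hs' : ∀ᵐ x ∂P, 2 * (Function.support x).ncard ≤ Fintype.card ι := by
      filter_upwards [hP.card_support] with x hx
      rw [hx]; exact hs
    let Z : (ι → ℝ) → ℂ := fun x =>
      ∑ j, g j * (x j : ℂ) - ((∑ j, x j : ℝ) : ℂ) * (∑ j, g j) / (Fintype.card ι : ℝ)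
    have hZ := measureReal_norm_gt_le_of_hasSubgaussianMGF (μ := P) (Z := Z) (c := 4 * M ^ 2)
      (by
        have := hasSubgaussianMGF_of_perm_invariant hperm hnorm hs' _ hre
        simpa only [Z, Complex.sub_re, Complex.re_sum, Complex.re_mul_ofReal,
          Complex.div_ofReal_re, Complex.re_ofReal_mul] using this)
      (by
        have := hasSubgaussianMGF_of_perm_invariant hperm hnorm hs' _ him
        simpa only [Z, Complex.sub_im, Complex.im_sum, Complex.im_mul_ofReal,
          Complex.div_ofReal_im, Complex.im_ofReal_mul] using this) hv
    refine le_trans (ENNReal.toReal_mono (measure_ne_top _ _) (measure_mono_ae ?_)) hZ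
    filter_upwards [hcs] with x hx
    intro hlt
    have hlt : Real.sqrt s * ‖∑ j, g j‖ / Fintype.card ι + v < ‖∑ j, g j * (x j : ℂ)‖ := hlt
    show v < ‖Z x‖
    have h1 : ‖((∑ j, x j : ℝ) : ℂ) * (∑ j, g j) / (Fintype.card ι : ℝ)‖
        ≤ Real.sqrt s * ‖∑ j, g j‖ / Fintype.card ι := by
      rw [norm_div, norm_mul, Complex.norm_real, Complex.norm_real, Real.norm_eq_abs,
        Real.norm_natCast]
      gcongr
    have h2 := norm_sub_norm_le (∑ j, g j * (x j : ℂ))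
      (((∑ j, x j : ℝ) : ℂ) * (∑ j, g j) / (Fintype.card ι : ℝ))
    simp only [Z]
    linarith

end Generic

/-! ### Gaussian noise -/

section Noise

theorem hasSubgaussianMGF_map_iff {Ω Ω' : Type*} [MeasurableSpace Ω] [MeasurableSpace Ω']
    {μ : Measure Ω} {Y : Ω → Ω'} (hY : Measurable Y) {X : Ω' → ℝ} (hX : Measurable X) {c : ℝ≥0} :
    HasSubgaussianMGF X c (μ.map Y) ↔ HasSubgaussianMGF (fun ω => X (Y ω)) c μ := by
  refine ⟨fun h => h.of_map hY.aemeasurable, fun h => h.congr_identDistrib ?_⟩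
  exact ⟨(hX.comp hY).aemeasurable, hX.aemeasurable, (Measure.map_map hX hY).symm⟩

theorem ProbabilityTheory.HasSubgaussianMGF.const_mul_nnnorm {Ω : Type*} [MeasurableSpace Ω]
    {μ : Measure Ω} {X : Ω → ℝ} {c : ℝ≥0} (h : HasSubgaussianMGF X c μ) (r : ℝ) :
    HasSubgaussianMGF (fun ω => r * X ω) (‖r‖₊ ^ 2 * c) μ :=
  HasSubgaussianMGF.mono_param (h.const_mul r) (le_of_eq (by
    congr 1
    ext
    change r ^ 2 = _
    simp))

theorem hasSubgaussianMGF_id_gaussianReal (v : ℝ≥0) :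
    HasSubgaussianMGF (fun x : ℝ => x) v (gaussianReal 0 v) :=
  ⟨fun t => integrable_exp_mul_gaussianReal t, fun t => by
    rw [mgf_gaussianReal (X := fun x => x) (Measure.map_id' (μ := gaussianReal 0 v))]; simp⟩

theorem measurable_complex_mk : Measurable fun q : ℝ × ℝ => (⟨q.1, q.2⟩ : ℂ) :=
  Complex.measurableEquivRealProd.symm.measurable

instance isProbabilityMeasure_complexGaussianNoise (κ : Type*) [Fintype κ] (σ : ℝ) :
    IsProbabilityMeasure (complexGaussianNoise κ σ) := by
  have : IsProbabilityMeasure (((gaussianReal 0 (Real.toNNReal (σ ^ 2 / 2))).prod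
      (gaussianReal 0 (Real.toNNReal (σ ^ 2 / 2)))).map fun q : ℝ × ℝ => (⟨q.1, q.2⟩ : ℂ)) :=
    Measure.isProbabilityMeasure_map measurable_complex_mk.aemeasurable
  unfold complexGaussianNoise
  infer_instance

theorem hasSubgaussianMGF_re_sum_mul_complexGaussianNoise {κ : Type*} [Fintype κ] (σ : ℝ)
    {z : κ → ℂ} (hz : ∑ a, ‖z a‖ ^ 2 = 1) :
    HasSubgaussianMGF (fun E : κ → ℂ => (∑ a, z a * E a).re) (Real.toNNReal (σ ^ 2 / 2))
      (complexGaussianNoise κ σ) := by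
  set v : ℝ≥0 := Real.toNNReal (σ ^ 2 / 2) with hv
  set ν : Measure ℂ := ((gaussianReal 0 v).prod (gaussianReal 0 v)).map
    fun q : ℝ × ℝ => (⟨q.1, q.2⟩ : ℂ) with hν
  have : IsProbabilityMeasure ν := Measure.isProbabilityMeasure_map
    measurable_complex_mk.aemeasurable
  have hnoise : complexGaussianNoise κ σ = Measure.pi fun _ : κ => ν := rfl
  have hscalar : ∀ w : ℂ, HasSubgaussianMGF (fun e : ℂ => (w * e).re) (‖w‖₊ ^ 2 * v) ν := by
    intro w
    rw [hν, hasSubgaussianMGF_map_iff measurable_complex_mk (by fun_prop)]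
    have h1 : HasSubgaussianMGF (fun q : ℝ × ℝ => w.re * q.1) (‖w.re‖₊ ^ 2 * v)
        ((gaussianReal 0 v).prod (gaussianReal 0 v)) :=
      (hasSubgaussianMGF_map_iff measurable_fst (X := fun y => w.re * y) (by fun_prop)).1 (by
        rw [measurePreserving_fst.map_eq]
        exact HasSubgaussianMGF.const_mul_nnnorm (hasSubgaussianMGF_id_gaussianReal v) w.re)
    have h2 : HasSubgaussianMGF (fun q : ℝ × ℝ => -w.im * q.2) (‖-w.im‖₊ ^ 2 * v)
        ((gaussianReal 0 v).prod (gaussianReal 0 v)) :=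
      (hasSubgaussianMGF_map_iff measurable_snd (X := fun y => -w.im * y) (by fun_prop)).1 (by
        rw [measurePreserving_snd.map_eq]
        exact HasSubgaussianMGF.const_mul_nnnorm (hasSubgaussianMGF_id_gaussianReal v) (-w.im))
    have h3 := h1.add_of_indepFun h2 (indepFun_prod (μ := gaussianReal 0 v)
      (ν := gaussianReal 0 v) (X := fun x => w.re * x) (Y := fun x => -w.im * x)
      (by fun_prop) (by fun_prop))
    convert h3 using 1
    · ext q
      simp only [Complex.mul_re]; ring
    · rw [← add_mul]
      congr 1
      ext
      push_cast
      rw [← Complex.normSq_eq_norm_sq, Complex.normSq_apply]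
      simp only [Real.norm_eq_abs, sq_abs]
      ring
  have hsum := HasSubgaussianMGF.sum_of_iIndepFun
    (iIndepFun_pi (μ := fun _ : κ => ν) (X := fun a (e : ℂ) => (z a * e).re)
      fun a => (by fun_prop : Measurable fun e : ℂ => (z a * e).re).aemeasurable)
    (c := fun a => ‖z a‖₊ ^ 2 * v) (s := Finset.univ) fun a _ => by
      have hX : Measurable fun e : ℂ => (z a * e).re := by fun_prop
      refine (hasSubgaussianMGF_map_iff (Y := fun f : κ → ℂ => f a)
        (measurable_pi_apply a) hX).1 ?_
      have := (measurePreserving_eval (fun _ : κ => ν) a).map_eq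
      rw [show (fun f : κ → ℂ => f a) = Function.eval a from rfl, this]
      exact hscalar (z a)
  have hc : ∑ a, ‖z a‖₊ ^ 2 * v = v := by
    rw [← Finset.sum_mul]
    have : ∑ a, ‖z a‖₊ ^ 2 = 1 := by
      ext; push_cast; exact hz
    rw [this, one_mul]
  rw [hnoise]
  rw [hc] at hsum
  simpa [Complex.re_sum] using hsum

/-- The noise seen by a unit vector has Gaussian tails; `M` may exceed the noise level `σ`, and has
to be positive because the tail bound with `M = 0` would read `exp (-0 / 0) = 1`. -/
theorem measureReal_norm_sum_mul_noise_gt_le {κ : Type*} [Fintype κ] {σ M : ℝ} (hσ : 0 ≤ σ)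
    (hσM : σ ≤ M) (hM : 0 < M) {z : κ → ℂ} (hz : ∑ a, ‖z a‖ ^ 2 = 1) {u : ℝ} (hu : 0 ≤ u) :
    (complexGaussianNoise κ σ).real {E | u * M < ‖∑ a, z a * E a‖}
      ≤ 4 * Real.exp (-u ^ 2 / 2) := by
  have hle : Real.toNNReal (σ ^ 2 / 2) ≤ Real.toNNReal (M ^ 2 / 2) :=
    Real.toNNReal_le_toNNReal (by gcongr)
  have hre := HasSubgaussianMGF.mono_param
    (hasSubgaussianMGF_re_sum_mul_complexGaussianNoise σ hz) hle
  have him := HasSubgaussianMGF.mono_param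
    (hasSubgaussianMGF_re_sum_mul_complexGaussianNoise σ (z := fun a => -Complex.I * z a)
      (by simpa using hz)) hle
  -- The imaginary part is the real part of the form rotated by `-i`.
  have hrot : (fun E : κ → ℂ => (∑ a, -Complex.I * z a * E a).re)
      = fun E => (∑ a, z a * E a).im := by
    ext E
    simp only [mul_assoc, ← Finset.mul_sum]
    simp
  rw [hrot] at him
  refine (measureReal_norm_gt_le_of_hasSubgaussianMGF hre him (by positivity)).trans (le_of_eq ?_)
  rw [Real.coe_toNNReal _ (by positivity)]
  congr 2
  field_simp
  ring

end Noise

/-! ### One-Step Thresholding for a fixed sensing matrix -/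

section OST

variable {κ ι : Type*} [Fintype κ]

theorem inner_column (Φ : Matrix κ ι ℂ) (i j : ι) :
    inner ℂ (column Φ i) (column Φ j) = (Φᴴ * Φ) i j := by
  simp [column, Matrix.mul_apply, PiLp.inner_apply, mul_comm]

theorem norm_column_eq_one {Φ : Matrix κ ι ℂ} {i : ι} (h : ∑ a, ‖Φ a i‖ ^ 2 = 1) :
    ‖column Φ i‖ = 1 := by
  simp [column, EuclideanSpace.norm_eq, h]

theorem worstCaseCoherence_nonneg (Φ : Matrix κ ι ℂ) : 0 ≤ worstCaseCoherence Φ :=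
  Real.iSup_nonneg fun _ => by positivity

variable [Fintype ι]

theorem norm_gram_le_worstCaseCoherence {Φ : Matrix κ ι ℂ} (hΦ : ∀ i, ∑ a, ‖Φ a i‖ ^ 2 = 1)
    {i j : ι} (hij : i ≠ j) : ‖(Φᴴ * Φ) i j‖ ≤ worstCaseCoherence Φ := by
  have h := le_ciSup (f := fun q : {q : ι × ι // q.1 ≠ q.2} =>
    ‖inner ℂ (column Φ q.1.2) (column Φ q.1.1)‖ / (‖column Φ q.1.2‖ * ‖column Φ q.1.1‖))
    (Set.finite_range _).bddAbove ⟨(j, i), hij.symm⟩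
  simpa [inner_column, norm_column_eq_one (hΦ _), worstCaseCoherence] using h

/-- Thresholding succeeds as soon as the filtered data are within the threshold of the object. -/
theorem ostLocalizes_of_forall_norm_sub_le {Φ : Matrix κ ι ℂ} {σ : ℝ} {x : ι → ℝ} {e : κ → ℂ}
    (h : ∀ i, ‖(Φᴴ *ᵥ noisyData Φ x e) i - x i‖ ≤ ostThreshold Φ σ)
    (hmin : 2 * ostThreshold Φ σ < minStrength x) : OSTLocalizes Φ σ x e := by
  ext i
  simp only [ostSupport, Set.mem_ofPred_eq, Function.mem_support]
  constructor
  · intro hi hx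
    have := h i
    rw [hx] at this
    simp only [Complex.ofReal_zero, sub_zero] at this
    linarith
  · intro hi
    have h1 : minStrength x ≤ |x i| := ciInf_le (f := fun i : Function.support x => |x i|)
      (Set.finite_range _).bddBelow ⟨i, hi⟩
    have h2 := norm_sub_norm_le (x i : ℂ) ((x i : ℂ) - (Φᴴ *ᵥ noisyData Φ x e) i)
    rw [norm_sub_rev (x i : ℂ) _, sub_sub_cancel, Complex.norm_real, Real.norm_eq_abs] at h2
    linarith [h i]

theorem matchedFilter_sub_eq [DecidableEq ι] {Φ : Matrix κ ι ℂ} {i : ι}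
    (hΦ : ∑ a, ‖Φ a i‖ ^ 2 = 1) (x : ι → ℝ) (e : κ → ℂ) :
    (Φᴴ *ᵥ noisyData Φ x e) i - x i
      = ∑ j, (if j = i then 0 else (Φᴴ * Φ) i j) * (x j : ℂ) + ∑ a, star (Φ a i) * e a := by
  have hii : (Φᴴ * Φ) i i = 1 := by
    rw [← inner_column, inner_self_eq_norm_sq_to_K, norm_column_eq_one hΦ]; simp
  have h1 : (Φᴴ *ᵥ noisyData Φ x e) i
      = ∑ j, (Φᴴ * Φ) i j * (x j : ℂ) + ∑ a, star (Φ a i) * e a := by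
    rw [noisyData, Matrix.mulVec_add, Matrix.mulVec_mulVec]
    rfl
  rw [h1, ← Finset.add_sum_erase Finset.univ (fun j => (Φᴴ * Φ) i j * (x j : ℂ))
    (Finset.mem_univ i), hii,
    ← Finset.add_sum_erase Finset.univ (fun j => (if j = i then 0 else (Φᴴ * Φ) i j) * (x j : ℂ))
    (Finset.mem_univ i)]
  have h2 : ∑ j ∈ Finset.univ.erase i, (if j = i then 0 else (Φᴴ * Φ) i j) * (x j : ℂ)
      = ∑ j ∈ Finset.univ.erase i, (Φᴴ * Φ) i j * (x j : ℂ) :=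
    Finset.sum_congr rfl fun j hj => by rw [if_neg (Finset.ne_of_mem_erase hj)]
  rw [h2]
  simp only [if_true]
  ring

/-- The coherence conditions for One-Step Thresholding: if the mean interference
`√s ‖∑_{j ≠ i} ⟨Φ_i, Φ_j⟩‖ / N` is dominated by the worst-case coherence, then the interference of
a generic object is at most `9 μ √(log N)` and the noise at most half of the threshold. -/
theorem measureReal_exists_lt_norm_matchedFilter_sub_le [DecidableEq ι] {Φ : Matrix κ ι ℂ}
    (hΦ : ∀ i, ∑ a, ‖Φ a i‖ ^ 2 = 1) (hμ : 0 < worstCaseCoherence Φ)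
    (hN : 2 ≤ Fintype.card ι) {s : ℕ} (hs : 2 * s ≤ Fintype.card ι)
    (hmean : ∀ i, Real.sqrt s * ‖∑ j, if j = i then 0 else (Φᴴ * Φ) i j‖ / Fintype.card ι
      ≤ worstCaseCoherence Φ * Real.sqrt (Real.log (Fintype.card ι)))
    {σ : ℝ} (hσ : 0 ≤ σ) {P : Measure (ι → ℝ)} [IsProbabilityMeasure P] (hP : IsGenericSparse s P)
    (hnorm : ∀ᵐ x ∂P, ∑ j, x j ^ 2 = 1) :
    (P.prod (complexGaussianNoise κ σ)).real
      {xe | ∃ i, ostThreshold Φ σ < ‖(Φᴴ *ᵥ noisyData Φ xe.1 xe.2) i - xe.1 i‖}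
      ≤ 8 / Fintype.card ι := by
  have : Nonempty ι := Fintype.card_pos_iff.1 (by omega)
  set N := Fintype.card ι with hNdef
  set L := Real.log N with hL
  set μ := worstCaseCoherence Φ with hμdef
  set M := max σ (12 * μ * Real.sqrt 2) with hM
  have hN1 : (2 : ℝ) ≤ N := by exact_mod_cast hN
  have hL0 : 0 < L := Real.log_pos (by linarith)
  have hLs : Real.sqrt L ^ 2 = L := Real.sq_sqrt hL0.le
  have hs2 : (1 : ℝ) ≤ Real.sqrt 2 := Real.one_le_sqrt.2 (by norm_num)
  have hMμ : 12 * μ ≤ M := le_trans (by nlinarith) (le_max_right _ _)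
  have hM0 : 0 < M := by linarith
  have hτ : ostThreshold Φ σ = 4 * Real.sqrt L * M := rfl
  have hexp : ∀ k : ℕ, Real.exp (-(k * L)) = 1 / (N : ℝ) ^ k := by
    intro k
    rw [Real.exp_neg, Real.exp_nat_mul, Real.exp_log (by linarith), one_div]
  let g : ι → ι → ℂ := fun i j => if j = i then 0 else (Φᴴ * Φ) i j
  let A : ι → Set (ι → ℝ) := fun i =>
    {x | 9 * μ * Real.sqrt L < ‖∑ j, g i j * (x j : ℂ)‖}
  let B : ι → Set (κ → ℂ) := fun i =>
    {e | 2 * Real.sqrt L * M < ‖∑ a, star (Φ a i) * e a‖}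
  have hA : ∀ i, P.real (A i) ≤ 4 / (N : ℝ) ^ 4 := by
    intro i
    have h := measureReal_norm_sum_mul_gt_le_of_isGenericSparse hP hnorm hs (g i)
      (M := ⟨μ, hμ.le⟩) (fun j => by
        by_cases hj : j = i
        · simp only [g, hj, if_true, norm_zero]; exact hμ.le
        · simp only [g, hj, if_false]
          exact norm_gram_le_worstCaseCoherence hΦ (Ne.symm hj))
      (v := 8 * μ * Real.sqrt L) (by positivity)
    refine (measureReal_mono ?_).trans (h.trans (le_of_eq ?_))
    · intro x hx
      have hx : 9 * μ * Real.sqrt L < ‖∑ j, g i j * (x j : ℂ)‖ := hx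
      refine lt_of_le_of_lt ?_ hx
      have : Real.sqrt s * ‖∑ j, g i j‖ / N ≤ μ * Real.sqrt L := hmean i
      linarith
    · have : -(8 * μ * Real.sqrt L) ^ 2 / (16 * μ ^ 2) = -((4 : ℕ) * L) := by
        rw [mul_pow, hLs]; push_cast; field_simp; ring
      show 4 * Real.exp (-(8 * μ * Real.sqrt L) ^ 2 / (16 * μ ^ 2)) = _
      rw [this, hexp]; ring
  have hB : ∀ i, (complexGaussianNoise κ σ).real (B i) ≤ 4 / (N : ℝ) ^ 2 := by
    intro i
    have h := measureReal_norm_sum_mul_noise_gt_le hσ (le_max_left σ (12 * μ * Real.sqrt 2)) hM0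
      (z := fun a => star (Φ a i)) (by simpa using hΦ i) (u := 2 * Real.sqrt L) (by positivity)
    refine h.trans (le_of_eq ?_)
    have : -(2 * Real.sqrt L) ^ 2 / 2 = -((2 : ℕ) * L) := by
      rw [mul_pow, hLs]; push_cast; ring
    rw [this, hexp]; ring
  have hsub : {xe : (ι → ℝ) × (κ → ℂ) |
      ∃ i, ostThreshold Φ σ < ‖(Φᴴ *ᵥ noisyData Φ xe.1 xe.2) i - xe.1 i‖}
      ⊆ ⋃ i ∈ (Finset.univ : Finset ι), (A i ×ˢ Set.univ) ∪ (Set.univ ×ˢ B i) := by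
    rintro ⟨x, e⟩ ⟨i, hi⟩
    simp only [Finset.mem_univ, Set.iUnion_true, Set.mem_iUnion, Set.mem_union, Set.mem_prod,
      Set.mem_univ, and_true, true_and]
    refine ⟨i, ?_⟩
    by_contra hcon
    rw [not_or] at hcon
    have h1 : ‖∑ j, g i j * (x j : ℂ)‖ ≤ 9 * μ * Real.sqrt L := not_lt.1 hcon.1
    have h2 : ‖∑ a, star (Φ a i) * e a‖ ≤ 2 * Real.sqrt L * M := not_lt.1 hcon.2
    rw [hτ, matchedFilter_sub_eq (hΦ i)] at hi
    have h3 := norm_add_le (∑ j, g i j * (x j : ℂ)) (∑ a, star (Φ a i) * e a)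
    have h4 : 9 * μ * Real.sqrt L ≤ M * Real.sqrt L := by gcongr; linarith
    have h5 : 0 ≤ M * Real.sqrt L := by positivity
    have hi : 4 * Real.sqrt L * M < ‖∑ j, g i j * (x j : ℂ) + ∑ a, star (Φ a i) * e a‖ := hi
    linarith
  calc (P.prod (complexGaussianNoise κ σ)).real _ ≤ _ := measureReal_mono hsub (measure_ne_top _ _)
    _ ≤ ∑ i, (P.prod (complexGaussianNoise κ σ)).real ((A i ×ˢ Set.univ) ∪ (Set.univ ×ˢ B i)) :=
        measureReal_biUnion_finset_le _ _
    _ ≤ ∑ _i : ι, (4 / (N : ℝ) ^ 4 + 4 / (N : ℝ) ^ 2) := by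
        refine Finset.sum_le_sum fun i _ => (measureReal_union_le _ _).trans ?_
        rw [measureReal_prod_prod, measureReal_prod_prod, probReal_univ, probReal_univ, mul_one,
          one_mul]
        exact add_le_add (hA i) (hB i)
    _ ≤ 8 / N := by
        rw [Finset.sum_const, Finset.card_univ, nsmul_eq_mul, ← hNdef]
        have h1 : 4 / (N : ℝ) ^ 4 ≤ 4 / (N : ℝ) ^ 2 := by
          gcongr
          · linarith
          · norm_num
        have h2 : (N : ℝ) * (4 / (N : ℝ) ^ 2 + 4 / (N : ℝ) ^ 2) = 8 / N := by
          field_simp; norm_num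
        rw [← h2]
        gcongr

end OST

/-! ### The Welch bound -/

section Welch

variable {κ ι : Type*} [Fintype κ] [Fintype ι]

theorem trace_mul_self_eq_sum_norm_sq {A : Matrix ι ι ℂ} (hA : Aᴴ = A) :
    (A * A).trace = ((∑ i, ∑ j, ‖A i j‖ ^ 2 : ℝ) : ℂ) := by
  simp only [Matrix.trace, Matrix.diag_apply, Matrix.mul_apply]
  push_cast
  refine Finset.sum_congr rfl fun i _ => Finset.sum_congr rfl fun j _ => ?_
  have : A j i = star (A i j) := by
    conv_lhs => rw [← hA]
    rfl
  rw [this, Complex.star_def, Complex.mul_conj, Complex.normSq_eq_norm_sq]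
  push_cast; rfl

/-- The Welch bound for a matrix all of whose entries have modulus `1 / √m`, `m` the number of rows.
The Gram matrices `Φᴴ Φ` and `Φ Φᴴ` have the same Frobenius norm, and the diagonal entries of the
latter are all equal to `N / m`. -/
theorem welch_bound {Φ : Matrix κ ι ℂ} [Nonempty κ]
    (hΦ : ∀ a j, ‖Φ a j‖ ^ 2 = 1 / (Fintype.card κ : ℝ)) :
    (Fintype.card ι : ℝ) * ((Fintype.card ι : ℝ) - Fintype.card κ)
      ≤ Fintype.card κ * ((Fintype.card ι : ℝ) * ((Fintype.card ι : ℝ) - 1)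
        * worstCaseCoherence Φ ^ 2) := by
  classical
  set N : ℝ := (Fintype.card ι : ℝ) with hN
  set m : ℝ := (Fintype.card κ : ℝ) with hm
  have hm0 : 0 < m := by rw [hm]; exact_mod_cast Fintype.card_pos
  have hcol : ∀ i, ∑ a, ‖Φ a i‖ ^ 2 = 1 := by
    intro i
    simp only [hΦ, Finset.sum_const, Finset.card_univ, nsmul_eq_mul, ← hm]
    field_simp
  have htr : (Φᴴ * Φ * (Φᴴ * Φ)).trace = (Φ * Φᴴ * (Φ * Φᴴ)).trace := by
    rw [Matrix.mul_assoc, Matrix.trace_mul_comm]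
    simp only [Matrix.mul_assoc]
  rw [trace_mul_self_eq_sum_norm_sq (by simp), trace_mul_self_eq_sum_norm_sq (by simp)] at htr
  have htr := Complex.ofReal_injective htr
  have hdiag : ∀ a, ‖(Φ * Φᴴ) a a‖ = N / m := by
    intro a
    have : (Φ * Φᴴ) a a = ((N / m : ℝ) : ℂ) := by
      rw [Matrix.mul_apply]
      have h1 : ∀ j, Φ a j * Φᴴ j a = ((1 / m : ℝ) : ℂ) := by
        intro j
        rw [Matrix.conjTranspose_apply, Complex.star_def, Complex.mul_conj,
          Complex.normSq_eq_norm_sq, hΦ]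
      simp only [h1, Finset.sum_const, Finset.card_univ, nsmul_eq_mul]
      push_cast
      rw [hN]; push_cast; ring
    rw [this, Complex.norm_real, Real.norm_eq_abs, abs_of_nonneg (by positivity)]
  have hlow : N ^ 2 / m ≤ ∑ a, ∑ b, ‖(Φ * Φᴴ) a b‖ ^ 2 := by
    calc N ^ 2 / m = ∑ a : κ, ‖(Φ * Φᴴ) a a‖ ^ 2 := by
          simp only [hdiag, Finset.sum_const, Finset.card_univ, nsmul_eq_mul, ← hm]
          field_simp
      _ ≤ _ := Finset.sum_le_sum fun a _ =>
          Finset.single_le_sum (f := fun b => ‖(Φ * Φᴴ) a b‖ ^ 2) (fun b _ => by positivity)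
            (Finset.mem_univ a)
  have hup : ∑ i, ∑ j, ‖(Φᴴ * Φ) i j‖ ^ 2
      ≤ N + N * (N - 1) * worstCaseCoherence Φ ^ 2 := by
    have hrow : ∀ i, ∑ j, ‖(Φᴴ * Φ) i j‖ ^ 2 ≤ 1 + (N - 1) * worstCaseCoherence Φ ^ 2 := by
      intro i
      rw [← Finset.add_sum_erase Finset.univ _ (Finset.mem_univ i)]
      have h1 : ‖(Φᴴ * Φ) i i‖ ^ 2 = 1 := by
        rw [← inner_column, inner_self_eq_norm_sq_to_K, norm_column_eq_one (hcol i)]; simp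
      have h2 : ∑ j ∈ Finset.univ.erase i, ‖(Φᴴ * Φ) i j‖ ^ 2
          ≤ ∑ _j ∈ Finset.univ.erase i, worstCaseCoherence Φ ^ 2 := by
        refine Finset.sum_le_sum fun j hj => ?_
        gcongr
        exact norm_gram_le_worstCaseCoherence hcol (Finset.ne_of_mem_erase hj).symm
      rw [Finset.sum_const, Finset.card_erase_of_mem (Finset.mem_univ i), Finset.card_univ,
        nsmul_eq_mul, Nat.cast_sub (Fintype.card_pos_iff.2 ⟨i⟩), Nat.cast_one] at h2
      linarith
    calc _ ≤ ∑ _i : ι, (1 + (N - 1) * worstCaseCoherence Φ ^ 2) :=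
          Finset.sum_le_sum fun i _ => hrow i
      _ = _ := by
          rw [Finset.sum_const, Finset.card_univ, nsmul_eq_mul, ← hN]; ring
  have h := (hlow.trans htr.symm.le).trans hup
  rw [div_le_iff₀ hm0] at h
  nlinarith

end Welch

/-! ### Geometry of the sensing matrix -/

section Geometry

/-- The paraxial phase factor `exp (i ω |x - ξ|² / (2 z₀))` in one coordinate. -/
noncomputable def chirp (lam z₀ x ξ : ℝ) : ℂ :=
  Complex.exp (Complex.I * ((2 * Real.pi / lam * |x - ξ| ^ 2 / (2 * z₀) : ℝ) : ℂ))

/-- The paraxial phase factor between a grid point and a sensor. -/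
noncomputable def propagator {r : ℕ} (ℓ lam z₀ : ℝ) (u : ℝ × ℝ) (j : Grid r) : ℂ :=
  chirp lam z₀ (gridX ℓ j) u.1 * chirp lam z₀ (gridY ℓ j) u.2

theorem norm_chirp (lam z₀ x ξ : ℝ) : ‖chirp lam z₀ x ξ‖ = 1 :=
  Complex.norm_exp_I_mul_ofReal _

theorem norm_propagator {r : ℕ} (ℓ lam z₀ : ℝ) (u : ℝ × ℝ) (j : Grid r) :
    ‖propagator ℓ lam z₀ u j‖ = 1 := by
  rw [propagator, norm_mul, norm_chirp, norm_chirp, one_mul]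

variable {p n r : ℕ} {ℓ lam z₀ A : ℝ}

theorem sensingMatrix_apply (c : Config p n r) (kl : Fin p × Fin n) (j : Grid r) :
    sensingMatrix ℓ lam z₀ c kl j = ((1 / Real.sqrt ((n : ℝ) * p) : ℝ) : ℂ)
      * propagator ℓ lam z₀ (c.2 kl.2) j * Complex.exp (Complex.I * ((c.1 (kl.1, j) : ℝ) : ℂ)) := by
  simp only [sensingMatrix, Matrix.of_apply, propagator, chirp, mul_assoc]

theorem norm_sensingMatrix_apply_sq (c : Config p n r) (kl : Fin p × Fin n) (j : Grid r) :
    ‖sensingMatrix ℓ lam z₀ c kl j‖ ^ 2 = 1 / ((n : ℝ) * p) := by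
  rw [sensingMatrix_apply, norm_mul, norm_mul, norm_propagator, Complex.norm_exp_I_mul_ofReal,
    Complex.norm_real, mul_one, mul_one, Real.norm_eq_abs, sq_abs, div_pow, one_pow,
    Real.sq_sqrt (by positivity)]

theorem sum_norm_sensingMatrix_sq (hn : 0 < n) (hp : 0 < p) (c : Config p n r) (j : Grid r) :
    ∑ a, ‖sensingMatrix ℓ lam z₀ c a j‖ ^ 2 = 1 := by
  simp only [norm_sensingMatrix_apply_sq, Finset.sum_const, Finset.card_univ, Fintype.card_prod,
    Fintype.card_fin, nsmul_eq_mul]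
  push_cast
  field_simp

theorem gram_sensingMatrix_apply (c : Config p n r) (i j : Grid r) :
    ((sensingMatrix ℓ lam z₀ c)ᴴ * sensingMatrix ℓ lam z₀ c) i j
      = ∑ k, (((1 / ((n : ℝ) * p) : ℝ) : ℂ) * star (Complex.exp (Complex.I * (c.1 (k, i) : ℂ)))
          * ∑ l, star (propagator ℓ lam z₀ (c.2 l) i) * propagator ℓ lam z₀ (c.2 l) j)
        * Complex.exp (Complex.I * (c.1 (k, j) : ℂ)) := by
  rw [Matrix.mul_apply, Fintype.sum_prod_type]
  refine Finset.sum_congr rfl fun k _ => ?_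
  rw [Finset.mul_sum, Finset.sum_mul]
  refine Finset.sum_congr rfl fun l _ => ?_
  have h : ((1 / Real.sqrt ((n : ℝ) * p) : ℝ) : ℂ) * ((1 / Real.sqrt ((n : ℝ) * p) : ℝ) : ℂ)
      = ((1 / ((n : ℝ) * p) : ℝ) : ℂ) := by
    rw [← Complex.ofReal_mul]
    congr 1
    rw [div_mul_div_comm, one_mul, Real.mul_self_sqrt (by positivity)]
  rw [Matrix.conjTranspose_apply, sensingMatrix_apply, sensingMatrix_apply, ← h, star_mul',
    star_mul', Complex.star_def, Complex.conj_ofReal]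
  ring

/-- At the Rayleigh resolution `A ℓ = λ z₀` the quadratic phases of two distinct sensors differ by a
nontrivial character of `ℤ / r` along the grid, so their correlation over the grid vanishes. -/
theorem sum_chirp_mul_star_eq_zero (hr : 0 < r) (hlam : 0 < lam) (hz₀ : 0 < z₀)
    (hrayleigh : A * ℓ / (lam * z₀) = 1) {ξ ξ' : ℝ} (hξ : ξ ∈ sensorSet A r)
    (hξ' : ξ' ∈ sensorSet A r) (hne : ξ ≠ ξ') :
    ∑ a : Fin r, chirp lam z₀ (((a : ℕ) + 1 : ℝ) * ℓ) ξ
      * star (chirp lam z₀ (((a : ℕ) + 1 : ℝ) * ℓ) ξ') = 0 := by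
  obtain ⟨q, hq1, hqr, rfl⟩ := hξ
  obtain ⟨q', hq1', hqr', rfl⟩ := hξ'
  have hqq : q ≠ q' := fun h => hne (by rw [h])
  have hr0 : (r : ℝ) ≠ 0 := by positivity
  have hrC : (r : ℂ) ≠ 0 := by exact_mod_cast hr.ne'
  set ζ : ℂ := Complex.exp (2 * Real.pi * Complex.I * (((q' : ℂ) - q) / r)) with hζ
  set C : ℝ := 2 * Real.pi / lam / (2 * z₀) * ((q * A / r) ^ 2 - (q' * A / r) ^ 2) with hC
  have hterm : ∀ a : Fin r, chirp lam z₀ (((a : ℕ) + 1 : ℝ) * ℓ) (q * A / r)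
      * star (chirp lam z₀ (((a : ℕ) + 1 : ℝ) * ℓ) (q' * A / r))
      = Complex.exp (Complex.I * C) * ζ * ζ ^ (a : ℕ) := by
    intro a
    rw [chirp, chirp, Complex.star_def, ← Complex.exp_conj, ← Complex.exp_add, mul_assoc,
      ← pow_succ', hζ, ← Complex.exp_nat_mul, ← Complex.exp_add]
    congr 1
    rw [map_mul, Complex.conj_I, Complex.conj_ofReal, sq_abs, sq_abs]
    have hreal : 2 * Real.pi / lam * ((((a : ℕ) + 1 : ℝ) * ℓ) - q * A / r) ^ 2 / (2 * z₀)
        - 2 * Real.pi / lam * ((((a : ℕ) + 1 : ℝ) * ℓ) - q' * A / r) ^ 2 / (2 * z₀)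
        = C + ((a : ℕ) + 1 : ℝ) * (2 * Real.pi * ((q' - q) / r)) := by
      have : 2 * Real.pi / lam * ((((a : ℕ) + 1 : ℝ) * ℓ) - q * A / r) ^ 2 / (2 * z₀)
        - 2 * Real.pi / lam * ((((a : ℕ) + 1 : ℝ) * ℓ) - q' * A / r) ^ 2 / (2 * z₀)
        = C + ((a : ℕ) + 1 : ℝ) * (2 * Real.pi * ((q' - q) / r)) * (A * ℓ / (lam * z₀)) := by
        rw [hC]; field_simp; ring
      rw [this, hrayleigh, mul_one]
    have hcast := congrArg (fun y : ℝ => (y : ℂ)) hreal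
    push_cast at hcast ⊢
    linear_combination Complex.I * hcast
  rw [Finset.sum_congr rfl fun a _ => hterm a, ← Finset.mul_sum,
    Fin.sum_univ_eq_sum_range fun a => ζ ^ a]
  have hζr : ζ ^ r = 1 := by
    rw [hζ, ← Complex.exp_nat_mul, Complex.exp_eq_one_iff]
    refine ⟨(q' : ℤ) - q, ?_⟩
    push_cast
    field_simp
  have hζ1 : ζ ≠ 1 := by
    rw [hζ, Ne, Complex.exp_eq_one_iff]
    rintro ⟨d, hd⟩
    have h2 : ((q' : ℂ) - q) / r = d := by
      have := Complex.two_pi_I_ne_zero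
      exact mul_left_cancel₀ this (by rw [hd]; ring)
    rw [div_eq_iff hrC] at h2
    have h3 : (q' : ℤ) - q = d * r := by exact_mod_cast h2
    have h4 : d ≠ 0 := by
      rintro rfl
      apply hqq
      omega
    have h5 : |(q' : ℤ) - q| < r := abs_lt.2 ⟨by omega, by omega⟩
    rw [h3, abs_mul, Nat.abs_cast] at h5
    have h6 := Int.one_le_abs h4
    have hr' : (0 : ℤ) < r := by exact_mod_cast hr
    nlinarith
  have hgeom : ∑ a ∈ Finset.range r, ζ ^ a = 0 := by
    have h := mul_geom_sum ζ r
    rw [hζr, sub_self] at h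
    exact (mul_eq_zero.1 h).resolve_left (sub_ne_zero.2 hζ1)
  rw [hgeom, mul_zero]

theorem sum_propagator_mul_star_eq_zero (hr : 0 < r) (hlam : 0 < lam) (hz₀ : 0 < z₀)
    (hrayleigh : A * ℓ / (lam * z₀) = 1) {u v : ℝ × ℝ} (hu : u ∈ sensorSet A r ×ˢ sensorSet A r)
    (hv : v ∈ sensorSet A r ×ˢ sensorSet A r) (hne : u ≠ v) :
    ∑ j : Grid r, propagator ℓ lam z₀ u j * star (propagator ℓ lam z₀ v j) = 0 := by
  have hfac : ∑ j : Grid r, propagator ℓ lam z₀ u j * star (propagator ℓ lam z₀ v j)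
      = (∑ a : Fin r, chirp lam z₀ (((a : ℕ) + 1 : ℝ) * ℓ) u.1
          * star (chirp lam z₀ (((a : ℕ) + 1 : ℝ) * ℓ) v.1))
        * ∑ b : Fin r, chirp lam z₀ (((b : ℕ) + 1 : ℝ) * ℓ) u.2
          * star (chirp lam z₀ (((b : ℕ) + 1 : ℝ) * ℓ) v.2) := by
    rw [Finset.sum_mul_sum, Fintype.sum_prod_type]
    refine Finset.sum_congr rfl fun a _ => Finset.sum_congr rfl fun b _ => ?_
    simp only [propagator, gridX, gridY, star_mul']
    ring
  rw [hfac]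
  by_cases h1 : u.1 = v.1
  · have h2 : u.2 ≠ v.2 := fun h => hne (Prod.ext h1 h)
    rw [sum_chirp_mul_star_eq_zero hr hlam hz₀ hrayleigh hu.2 hv.2 h2, mul_zero]
  · rw [sum_chirp_mul_star_eq_zero hr hlam hz₀ hrayleigh hu.1 hv.1 h1, zero_mul]

open Classical in
/-- The number of ordered pairs of distinct sensors placed at the same point. -/
noncomputable def collisions (η : Fin n → ℝ × ℝ) : ℝ :=
  ∑ l, ∑ l', if l ≠ l' ∧ η l = η l' then 1 else 0

/-- By orthogonality only coinciding sensors contribute to the energy of the correlations of a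
fixed grid point with all grid points. -/
theorem sum_norm_sum_star_propagator_sq_le (hr : 0 < r) (hlam : 0 < lam) (hz₀ : 0 < z₀)
    (hrayleigh : A * ℓ / (lam * z₀) = 1) {η : Fin n → ℝ × ℝ}
    (hη : ∀ l, η l ∈ sensorSet A r ×ˢ sensorSet A r) (i : Grid r) :
    ∑ j : Grid r, ‖∑ l, star (propagator ℓ lam z₀ (η l) i) * propagator ℓ lam z₀ (η l) j‖ ^ 2
      ≤ (r : ℝ) ^ 2 * (n + collisions η) := by
  classical
  let f : Fin n → Grid r → ℂ := fun l j => propagator ℓ lam z₀ (η l) j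
  have hf : ∀ l j, ‖f l j‖ = 1 := fun l j => norm_propagator _ _ _ _ _
  have hexpand : ((∑ j : Grid r, ‖∑ l, star (f l i) * f l j‖ ^ 2 : ℝ) : ℂ)
      = ∑ l, ∑ l', star (f l i) * f l' i * ∑ j, f l j * star (f l' j) := by
    push_cast
    have h1 : ∀ j, (‖∑ l, star (f l i) * f l j‖ : ℂ) ^ 2
        = ∑ l, ∑ l', star (f l i) * f l' i * (f l j * star (f l' j)) := by
      intro j
      rw [← Complex.mul_conj', ← Complex.star_def, star_sum, Finset.sum_mul_sum]
      refine Finset.sum_congr rfl fun l _ => Finset.sum_congr rfl fun l' _ => ?_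
      rw [star_mul', star_star]; ring
    rw [Finset.sum_congr rfl fun j _ => h1 j, Finset.sum_comm]
    refine Finset.sum_congr rfl fun l _ => ?_
    rw [Finset.sum_comm]
    exact Finset.sum_congr rfl fun l' _ => (Finset.mul_sum _ _ _).symm
  have hpair : ∀ l l', ‖star (f l i) * f l' i * ∑ j, f l j * star (f l' j)‖
      ≤ (r : ℝ) ^ 2 * ((if l = l' then 1 else 0) + if l ≠ l' ∧ η l = η l' then 1 else 0) := by
    intro l l'
    rw [norm_mul, norm_mul, norm_star, hf, hf, one_mul, one_mul]
    by_cases h : η l = η l'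
    · have h1 : (if l = l' then (1 : ℝ) else 0) + (if l ≠ l' ∧ η l = η l' then 1 else 0) = 1 := by
        by_cases hl : l = l' <;> simp [hl, h]
      rw [h1, mul_one]
      refine (norm_sum_le _ _).trans (le_of_eq ?_)
      simp [hf, sq]
    · have h1 : ∑ j, f l j * star (f l' j) = 0 :=
        sum_propagator_mul_star_eq_zero hr hlam hz₀ hrayleigh (hη l) (hη l') h
      rw [h1, norm_zero]
      positivity
  have hnonneg : 0 ≤ ∑ j : Grid r, ‖∑ l, star (f l i) * f l j‖ ^ 2 :=
    Finset.sum_nonneg fun _ _ => by positivity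
  calc ∑ j : Grid r, ‖∑ l, star (f l i) * f l j‖ ^ 2
      = ‖((∑ j : Grid r, ‖∑ l, star (f l i) * f l j‖ ^ 2 : ℝ) : ℂ)‖ := by
        rw [Complex.norm_real, Real.norm_eq_abs, abs_of_nonneg hnonneg]
    _ ≤ ∑ l, ∑ l', (r : ℝ) ^ 2
          * ((if l = l' then 1 else 0) + if l ≠ l' ∧ η l = η l' then 1 else 0) := by
        rw [hexpand]
        exact (norm_sum_le _ _).trans (Finset.sum_le_sum fun l _ => (norm_sum_le _ _).trans
          (Finset.sum_le_sum fun l' _ => hpair l l'))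
    _ = (r : ℝ) ^ 2 * (n + collisions η) := by
        simp only [← Finset.mul_sum, Finset.sum_add_distrib, collisions]
        simp

theorem continuous_sensingMatrix_apply (kl : Fin p × Fin n) (j : Grid r) :
    Continuous fun c : Config p n r => sensingMatrix ℓ lam z₀ c kl j := by
  simp only [sensingMatrix, Matrix.of_apply]
  fun_prop

theorem continuous_gram_sensingMatrix_apply (i j : Grid r) :
    Continuous fun c : Config p n r =>
      ((sensingMatrix ℓ lam z₀ c)ᴴ * sensingMatrix ℓ lam z₀ c) i j := by
  simp only [Matrix.mul_apply, Matrix.conjTranspose_apply]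
  exact continuous_finsetSum _ fun a _ => (continuous_star.comp
    (continuous_sensingMatrix_apply a i)).mul (continuous_sensingMatrix_apply a j)

end Geometry

/-! ### Random illumination and sensor positions -/

section Slices

variable {α β : Type*} [MeasurableSpace α] [MeasurableSpace β] {μ : Measure α} {ν : Measure β}
  [IsProbabilityMeasure μ] [IsProbabilityMeasure ν]

/-- A bound for all slices over `y ∉ B` bounds the measure of a product set, at the price of the
measure of `B`, which need not be measurable. -/
theorem measureReal_prod_le_add_of_forall_snd {T : Set (α × β)} (hT : MeasurableSet T)
    {B : Set β} {ε : ℝ} (hε : 0 ≤ ε) (h : ∀ᵐ y ∂ν, y ∉ B → μ.real {x | (x, y) ∈ T} ≤ ε) :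
    (μ.prod ν).real T ≤ ε + ν.real B := by
  have hle : (μ.prod ν) T ≤ ENNReal.ofReal ε + ν B := by
    rw [Measure.prod_apply_symm hT, ← measure_toMeasurable B]
    calc ∫⁻ y, μ ((fun x => (x, y)) ⁻¹' T) ∂ν
        ≤ ∫⁻ y, (ENNReal.ofReal ε + (toMeasurable ν B).indicator 1 y) ∂ν := by
          refine lintegral_mono_ae ?_
          filter_upwards [h] with y hy
          by_cases hyB : y ∈ toMeasurable ν B
          · rw [Set.indicator_of_mem hyB]
            exact prob_le_one.trans le_add_self
          · have := hy fun h => hyB (subset_toMeasurable ν B h)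
            refine le_trans ?_ le_self_add
            exact (ENNReal.le_ofReal_iff_toReal_le (measure_ne_top _ _) hε).2 this
      _ = ENNReal.ofReal ε + ν (toMeasurable ν B) := by
          rw [lintegral_add_left measurable_const, lintegral_const, measure_univ, mul_one,
            lintegral_indicator_one (measurableSet_toMeasurable _ _)]
  have := ENNReal.toReal_mono (by finiteness) hle
  rwa [ENNReal.toReal_add (by finiteness) (by finiteness), ENNReal.toReal_ofReal hε] at this

theorem measureReal_prod_le_add_of_forall_fst {T : Set (α × β)} (hT : MeasurableSet T)
    {B : Set α} {ε : ℝ} (hε : 0 ≤ ε) (h : ∀ᵐ x ∂μ, x ∉ B → ν.real {y | (x, y) ∈ T} ≤ ε) :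
    (μ.prod ν).real T ≤ ε + μ.real B := by
  have hswap : (μ.prod ν).real T = (ν.prod μ).real (Prod.swap ⁻¹' T) := by
    rw [measureReal_def, measureReal_def, ← Measure.prod_swap,
      Measure.map_apply measurable_swap hT]
  rw [hswap]
  exact measureReal_prod_le_add_of_forall_snd (measurable_swap hT) hε h

end Slices

section Phases

/-- The uniform law of a single phase on `[0, 2π]`. -/
noncomputable abbrev phaseLaw : Measure ℝ :=
  ProbabilityTheory.cond volume (Set.Icc 0 (2 * Real.pi))

instance isProbabilityMeasure_phaseLaw : IsProbabilityMeasure phaseLaw := by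
  refine cond_isProbabilityMeasure_of_finite ?_ ?_
  · rw [Real.volume_Icc]
    simp [Real.pi_pos]
  · rw [Real.volume_Icc]
    exact ENNReal.ofReal_ne_top

theorem integral_re_mul_exp_phaseLaw (a : ℂ) :
    ∫ θ, (a * Complex.exp (Complex.I * (θ : ℂ))).re ∂phaseLaw = 0 := by
  have h : ∀ θ : ℝ, (a * Complex.exp (Complex.I * (θ : ℂ))).re
      = a.re * Real.cos θ - a.im * Real.sin θ := by
    intro θ
    rw [mul_comm Complex.I, Complex.mul_re, Complex.exp_ofReal_mul_I_re,
      Complex.exp_ofReal_mul_I_im]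
  simp only [h]
  rw [phaseLaw, ProbabilityTheory.cond, integral_smul_measure, integral_Icc_eq_integral_Ioc,
    ← intervalIntegral.integral_of_le Real.two_pi_pos.le,
    intervalIntegral.integral_sub (Continuous.intervalIntegrable (by fun_prop) _ _)
      (Continuous.intervalIntegrable (by fun_prop) _ _)]
  simp

theorem hasSubgaussianMGF_re_mul_exp_phaseLaw (a : ℂ) :
    HasSubgaussianMGF (fun θ : ℝ => (a * Complex.exp (Complex.I * (θ : ℂ))).re) (‖a‖₊ ^ 2)
      phaseLaw := by
  have h := hasSubgaussianMGF_of_mem_Icc_of_integral_eq_zero (μ := phaseLaw)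
    (X := fun θ : ℝ => (a * Complex.exp (Complex.I * (θ : ℂ))).re) (a := -‖a‖) (b := ‖a‖)
    (by fun_prop) (Filter.Eventually.of_forall fun θ => by
      have := Complex.abs_re_le_norm (a * Complex.exp (Complex.I * (θ : ℂ)))
      rw [norm_mul, Complex.norm_exp_I_mul_ofReal, mul_one] at this
      exact abs_le.1 this) (integral_re_mul_exp_phaseLaw a)
  refine HasSubgaussianMGF.mono_param h (le_of_eq ?_)
  congr 1
  ext
  push_cast
  rw [Real.norm_eq_abs, abs_of_nonneg (by linarith [norm_nonneg a])]
  ring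

theorem hasSubgaussianMGF_re_sum_mul_exp_phaseLaw {α : Type*} [Fintype α] (a : α → ℂ) :
    HasSubgaussianMGF (fun θ : α → ℝ => (∑ i, a i * Complex.exp (Complex.I * (θ i : ℂ))).re)
      (∑ i, ‖a i‖₊ ^ 2) (Measure.pi fun _ : α => phaseLaw) := by
  have hX : ∀ i, Measurable fun θ : ℝ => (a i * Complex.exp (Complex.I * (θ : ℂ))).re :=
    fun i => by fun_prop
  have h := HasSubgaussianMGF.sum_of_iIndepFun
    (iIndepFun_pi (μ := fun _ : α => phaseLaw)
      (X := fun i (θ : ℝ) => (a i * Complex.exp (Complex.I * (θ : ℂ))).re)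
      fun i => (hX i).aemeasurable)
    (c := fun i => ‖a i‖₊ ^ 2) (s := Finset.univ) fun i _ => by
      refine (hasSubgaussianMGF_map_iff (Y := fun f : α → ℝ => f i)
        (measurable_pi_apply i) (hX i)).1 ?_
      have := (measurePreserving_eval (fun _ : α => phaseLaw) i).map_eq
      rw [show (fun f : α → ℝ => f i) = Function.eval i from rfl, this]
      exact hasSubgaussianMGF_re_mul_exp_phaseLaw (a i)
  simpa [Complex.re_sum] using h

theorem measureReal_norm_sum_mul_exp_gt_le {α : Type*} [Fintype α] {a : α → ℂ} {V u : ℝ}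
    (ha : ∑ i, ‖a i‖ ^ 2 ≤ V) (hu : 0 ≤ u) :
    (Measure.pi fun _ : α => phaseLaw).real
      {θ | u < ‖∑ i, a i * Complex.exp (Complex.I * (θ i : ℂ))‖}
      ≤ 4 * Real.exp (-u ^ 2 / (4 * V)) := by
  have hV : 0 ≤ V := le_trans (Finset.sum_nonneg fun _ _ => by positivity) ha
  have hle : ∀ b : α → ℂ, (∀ i, ‖b i‖ = ‖a i‖) → ∑ i, ‖b i‖₊ ^ 2 ≤ Real.toNNReal V := by
    intro b hb
    rw [← NNReal.coe_le_coe, Real.coe_toNNReal _ hV]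
    push_cast
    simpa only [hb] using ha
  have hre := HasSubgaussianMGF.mono_param (hasSubgaussianMGF_re_sum_mul_exp_phaseLaw a)
    (hle a fun _ => rfl)
  have him := HasSubgaussianMGF.mono_param
    (hasSubgaussianMGF_re_sum_mul_exp_phaseLaw fun i => -Complex.I * a i)
    (hle _ fun i => by simp)
  have hrot : (fun θ : α → ℝ =>
      (∑ i, -Complex.I * a i * Complex.exp (Complex.I * (θ i : ℂ))).re)
      = fun θ => (∑ i, a i * Complex.exp (Complex.I * (θ i : ℂ))).im := by
    ext θ
    simp only [mul_assoc, ← Finset.mul_sum]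
    simp
  rw [hrot] at him
  have h := measureReal_norm_gt_le_of_hasSubgaussianMGF hre him hu
  rwa [Real.coe_toNNReal _ hV] at h

/-- Conditional Hoeffding inequality: the coefficients of the independent phases with index in `q`
may depend on the remaining phases. -/
theorem measureReal_norm_sum_subtype_mul_exp_gt_le {α : Type*} [Fintype α] (q : α → Prop)
    [DecidablePred q] {a : ({i // ¬ q i} → ℝ) → {i // q i} → ℂ} (hac : Continuous a) {V u : ℝ}
    (ha : ∀ y, ∑ i, ‖a y i‖ ^ 2 ≤ V) (hu : 0 ≤ u) :
    (Measure.pi fun _ : α => phaseLaw).real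
      {θ | u < ‖∑ i : {i // q i}, a (fun y => θ y) i * Complex.exp (Complex.I * (θ i : ℂ))‖}
      ≤ 4 * Real.exp (-u ^ 2 / (4 * V)) := by
  let T : Set (({i // q i} → ℝ) × ({i // ¬ q i} → ℝ)) :=
    {z | u < ‖∑ i, a z.2 i * Complex.exp (Complex.I * (z.1 i : ℂ))‖}
  have hT : MeasurableSet T := by
    refine (isOpen_lt continuous_const ?_).measurableSet
    refine continuous_norm.comp (continuous_finsetSum _ fun i _ => Continuous.mul ?_ ?_)
    · exact (continuous_apply i).comp (hac.comp continuous_snd)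
    · fun_prop
  have hmp := measurePreserving_piEquivPiSubtypeProd (fun _ : α => phaseLaw) q
  have h := hmp.measureReal_preimage hT.nullMeasurableSet
  have hslice : ∀ y, (Measure.pi fun _ : {i // q i} => phaseLaw).real {x | (x, y) ∈ T}
      ≤ 4 * Real.exp (-u ^ 2 / (4 * V)) := fun y =>
    measureReal_norm_sum_mul_exp_gt_le (a := a y) (ha y) hu
  have h2 := measureReal_prod_le_add_of_forall_snd
    (μ := Measure.pi fun _ : {i // q i} => phaseLaw)
    (ν := Measure.pi fun _ : {i // ¬ q i} => phaseLaw) hT (B := ∅) (by positivity)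
    (Filter.Eventually.of_forall fun y _ => hslice y)
  rw [measureReal_empty, add_zero] at h2
  exact (le_of_eq h).trans h2

end Phases

section Sensors

/-- The law of a single sensor. -/
noncomputable abbrev sensorLaw (A : ℝ) (r : ℕ) : Measure (ℝ × ℝ) :=
  (uniformOn (sensorSet A r) : Measure ℝ).prod (uniformOn (sensorSet A r))

variable {A : ℝ} {r : ℕ}

theorem sensorSet_eq_coe_image (A : ℝ) (r : ℕ) :
    sensorSet A r = ((Finset.Icc 1 r).image fun q : ℕ => (q : ℝ) * A / r : Finset ℝ) := by
  ext x
  simp only [sensorSet, Set.mem_ofPred_eq, Finset.coe_image, Set.mem_image, Finset.coe_Icc,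
    Set.mem_Icc, and_assoc, eq_comm]

theorem finite_sensorSet (A : ℝ) (r : ℕ) : (sensorSet A r).Finite := by
  rw [sensorSet_eq_coe_image]; exact Finset.finite_toSet _

theorem nonempty_sensorSet (A : ℝ) (hr : 0 < r) : (sensorSet A r).Nonempty :=
  ⟨_, 1, le_rfl, hr, rfl⟩

theorem isProbabilityMeasure_uniformOn_sensorSet (A : ℝ) (hr : 0 < r) :
    IsProbabilityMeasure (uniformOn (sensorSet A r)) :=
  isProbabilityMeasure_uniformOn (finite_sensorSet A r) (nonempty_sensorSet A hr)

theorem uniformOn_sensorSet_singleton_le (hA : 0 < A) (hr : 0 < r) (x : ℝ) :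
    uniformOn (sensorSet A r) {x} ≤ (r : ℝ≥0∞)⁻¹ := by
  classical
  have hr' : (r : ℝ) ≠ 0 := by positivity
  have hinj : Function.Injective fun q : ℕ => (q : ℝ) * A / r := by
    intro a b hab
    have hab : (a : ℝ) * A / r = b * A / r := hab
    field_simp at hab
    exact_mod_cast hab
  rw [sensorSet_eq_coe_image, ← Finset.coe_singleton, uniformOn_apply_finset,
    Finset.card_image_of_injective _ hinj, Nat.card_Icc, Nat.add_sub_cancel, ← one_div]
  gcongr
  have : (Finset.image (fun q : ℕ => (q : ℝ) * A / r) (Finset.Icc 1 r) ∩ {x}).card ≤ 1 :=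
    (Finset.card_le_card Finset.inter_subset_right).trans (by simp)
  exact_mod_cast this

theorem ae_mem_sensorSet (A : ℝ) (r : ℕ) :
    ∀ᵐ x ∂(uniformOn (sensorSet A r) : Measure ℝ), x ∈ sensorSet A r := by
  rw [ae_iff]
  have : {x | x ∉ sensorSet A r} = (sensorSet A r)ᶜ := rfl
  rw [this, uniformOn_eq_zero_iff (finite_sensorSet A r), Set.inter_compl_self]

theorem ae_sensorLaw_mem (hr : 0 < r) :
    ∀ᵐ u ∂sensorLaw A r, u ∈ sensorSet A r ×ˢ sensorSet A r := by
  have := isProbabilityMeasure_uniformOn_sensorSet A hr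
  have h1 : ∀ᵐ u ∂sensorLaw A r, u.1 ∈ sensorSet A r :=
    Measure.quasiMeasurePreserving_fst.ae (ae_mem_sensorSet A r)
  have h2 : ∀ᵐ u ∂sensorLaw A r, u.2 ∈ sensorSet A r :=
    Measure.quasiMeasurePreserving_snd.ae (ae_mem_sensorSet A r)
  filter_upwards [h1, h2] with u hu1 hu2 using ⟨hu1, hu2⟩

theorem ae_pi_sensorLaw_mem {n : ℕ} (hr : 0 < r) :
    ∀ᵐ η ∂(Measure.pi fun _ : Fin n => sensorLaw A r),
      ∀ l, η l ∈ sensorSet A r ×ˢ sensorSet A r := by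
  have := isProbabilityMeasure_uniformOn_sensorSet A hr
  rw [ae_all_iff]
  intro l
  exact (Measure.quasiMeasurePreserving_eval (fun _ : Fin n => sensorLaw A r) l).ae
    (ae_sensorLaw_mem hr)

theorem sensorLaw_singleton_le (hA : 0 < A) (hr : 0 < r) (u : ℝ × ℝ) :
    sensorLaw A r {u} ≤ ((r : ℝ≥0∞) ^ 2)⁻¹ := by
  have := isProbabilityMeasure_uniformOn_sensorSet A hr
  obtain ⟨x, y⟩ := u
  rw [← Set.singleton_prod_singleton, Measure.prod_prod, sq,
    ENNReal.mul_inv (by simp) (by simp)]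
  gcongr <;> exact uniformOn_sensorSet_singleton_le hA hr _

theorem measureReal_sensors_eq_le {n : ℕ} (hA : 0 < A) (hr : 0 < r) {l l' : Fin n} (hl : l ≠ l') :
    (Measure.pi fun _ : Fin n => sensorLaw A r).real {η | η l = η l'} ≤ 1 / (r : ℝ) ^ 2 := by
  have := isProbabilityMeasure_uniformOn_sensorSet A hr
  have hind := (iIndepFun_pi (μ := fun _ : Fin n => sensorLaw A r) (X := fun _ u => u)
    fun _ => aemeasurable_id).indepFun hl
  rw [indepFun_iff_map_prod_eq_prod_map_map (measurable_pi_apply l).aemeasurable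
    (measurable_pi_apply l').aemeasurable] at hind
  have hev : ∀ k : Fin n, (Measure.pi fun _ : Fin n => sensorLaw A r).map (fun η => η k)
      = sensorLaw A r := fun k => (measurePreserving_eval (fun _ : Fin n => sensorLaw A r) k).map_eq
  rw [hev, hev] at hind
  have hdiag : MeasurableSet {z : (ℝ × ℝ) × (ℝ × ℝ) | z.1 = z.2} :=
    (isClosed_eq continuous_fst continuous_snd).measurableSet
  have h1 : (Measure.pi fun _ : Fin n => sensorLaw A r).real {η | η l = η l'}
      = ((sensorLaw A r).prod (sensorLaw A r)).real {z | z.1 = z.2} := by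
    rw [← hind, map_measureReal_apply (by fun_prop) hdiag]
    rfl
  rw [h1]
  have h2 := measureReal_prod_le_add_of_forall_snd (μ := sensorLaw A r) (ν := sensorLaw A r)
    hdiag (B := ∅) (ε := 1 / (r : ℝ) ^ 2) (by positivity)
    (Filter.Eventually.of_forall fun y _ => by
      have hy : {x : ℝ × ℝ | (x, y) ∈ {z : (ℝ × ℝ) × (ℝ × ℝ) | z.1 = z.2}} = {y} := by
        ext x; simp
      rw [hy, measureReal_def]
      refine (ENNReal.toReal_mono (by simp [hr.ne']) (sensorLaw_singleton_le hA hr y)).trans ?_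
      simp)
  simpa using h2

/-- Markov's inequality for the number of collisions, whose mean is at most `n² / N`. -/
theorem measureReal_le_collisions_le {n : ℕ} (hn : 0 < n) (hA : 0 < A) (hr : 0 < r) :
    (Measure.pi fun _ : Fin n => sensorLaw A r).real {η | (n : ℝ) ≤ collisions η}
      ≤ n / (r : ℝ) ^ 2 := by
  classical
  have := isProbabilityMeasure_uniformOn_sensorSet A hr
  set ν := Measure.pi fun _ : Fin n => sensorLaw A r with hν
  have hmeas : ∀ l l' : Fin n, MeasurableSet {η : Fin n → ℝ × ℝ | l ≠ l' ∧ η l = η l'} :=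
    fun l l' => (MeasurableSet.const _).inter
      (isClosed_eq (continuous_apply l) (continuous_apply l')).measurableSet
  have hind : ∀ l l' : Fin n, (fun η : Fin n → ℝ × ℝ => if l ≠ l' ∧ η l = η l' then (1 : ℝ) else 0)
      = {η : Fin n → ℝ × ℝ | l ≠ l' ∧ η l = η l'}.indicator fun _ => 1 := by
    intro l l'
    ext η
    simp [Set.indicator_apply]
  have hint : ∀ l l' : Fin n, Integrable
      (fun η : Fin n → ℝ × ℝ => if l ≠ l' ∧ η l = η l' then (1 : ℝ) else 0) ν := by
    intro l l'
    rw [hind]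
    exact (integrable_const _).indicator (hmeas l l')
  have hcoll : (fun η : Fin n → ℝ × ℝ => collisions η)
      = fun η => ∑ l, ∑ l', if l ≠ l' ∧ η l = η l' then (1 : ℝ) else 0 := by
    ext η
    simp only [collisions]
  have hmean : ∫ η, collisions η ∂ν ≤ n * (n / (r : ℝ) ^ 2) := by
    rw [hcoll, integral_finsetSum _ fun l _ => integrable_finsetSum _ fun l' _ => hint l l']
    calc ∑ l, ∫ η, ∑ l', (if l ≠ l' ∧ η l = η l' then (1 : ℝ) else 0) ∂ν
        ≤ ∑ _l : Fin n, ∑ _l' : Fin n, 1 / (r : ℝ) ^ 2 := by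
          refine Finset.sum_le_sum fun l _ => ?_
          rw [integral_finsetSum _ fun l' _ => hint l l']
          refine Finset.sum_le_sum fun l' _ => ?_
          rw [hind, integral_indicator_const _ (hmeas l l'), smul_eq_mul, mul_one]
          by_cases hl : l = l'
          · simp [hl]
          · exact (measureReal_mono fun η hη => hη.2).trans (measureReal_sensors_eq_le hA hr hl)
      _ = n * (n / (r : ℝ) ^ 2) := by
          simp only [Finset.sum_const, Finset.card_univ, Fintype.card_fin, nsmul_eq_mul]
          ring
  have hmarkov := mul_meas_ge_le_integral_of_nonneg (μ := ν) (f := fun η => collisions η)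
    (Filter.Eventually.of_forall fun η => Finset.sum_nonneg fun l _ =>
      Finset.sum_nonneg fun l' _ => by positivity)
    (by
      rw [hcoll]
      exact integrable_finsetSum _ fun l _ => integrable_finsetSum _ fun l' _ => hint l l') n
  have hn' : (0 : ℝ) < n := by exact_mod_cast hn
  exact le_of_mul_le_mul_left (hmarkov.trans hmean) hn'

end Sensors

/-! ### Column sums of the Gram matrix -/

section ColumnSums

variable {p n r : ℕ} {ℓ lam z₀ A : ℝ}

/-- The interference `∑_{j ≠ i} ⟨Φ_i, Φ_j⟩` at the grid point `i` of a constant object. -/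
noncomputable def interference (ℓ lam z₀ : ℝ) (c : Config p n r) (i : Grid r) : ℂ :=
  ∑ j, if j = i then 0 else ((sensingMatrix ℓ lam z₀ c)ᴴ * sensingMatrix ℓ lam z₀ c) i j

theorem continuous_interference (i : Grid r) :
    Continuous fun c : Config p n r => interference ℓ lam z₀ c i := by
  refine continuous_finsetSum _ fun j _ => ?_
  by_cases h : j = i
  · simp only [h, if_true]; exact continuous_const
  · simp only [h, if_false]; exact continuous_gram_sensingMatrix_apply i j

/-- Given the sensors and the phases at the grid point `i`, the interference at `i` is a linear form
in the remaining phases. -/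
theorem interference_eq_sum (η : Fin n → ℝ × ℝ) (θ : Fin p × Grid r → ℝ) (i : Grid r) :
    interference ℓ lam z₀ ((θ, η) : Config p n r) i
      = ∑ x : {x : Fin p × Grid r // x.2 ≠ i},
        (((1 / ((n : ℝ) * p) : ℝ) : ℂ) * star (Complex.exp (Complex.I * (θ (x.1.1, i) : ℂ)))
          * ∑ l, star (propagator ℓ lam z₀ (η l) i) * propagator ℓ lam z₀ (η l) x.1.2)
        * Complex.exp (Complex.I * (θ x : ℂ)) := by
  rw [← Finset.sum_subtype (Finset.univ.filter fun x : Fin p × Grid r => x.2 ≠ i) (by simp)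
    fun x : Fin p × Grid r =>
      (((1 / ((n : ℝ) * p) : ℝ) : ℂ) * star (Complex.exp (Complex.I * (θ (x.1, i) : ℂ)))
          * ∑ l, star (propagator ℓ lam z₀ (η l) i) * propagator ℓ lam z₀ (η l) x.2)
        * Complex.exp (Complex.I * (θ x : ℂ)), Finset.sum_filter, Fintype.sum_prod_type,
    Finset.sum_comm]
  refine Finset.sum_congr rfl fun j _ => ?_
  by_cases h : j = i
  · simp [h]
  · simp only [h, if_false, ne_eq, not_false_eq_true, if_true]
    exact gram_sensingMatrix_apply _ i j

theorem measureReal_phases_lt_norm_interference_le (hn : 0 < n) (hp : 0 < p) (hr : 0 < r)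
    (hlam : 0 < lam) (hz₀ : 0 < z₀) (hrayleigh : A * ℓ / (lam * z₀) = 1) {η : Fin n → ℝ × ℝ}
    (hη : ∀ l, η l ∈ sensorSet A r ×ˢ sensorSet A r) (hcoll : collisions η ≤ n) {u : ℝ}
    (hu : 0 ≤ u) (i : Grid r) :
    (Measure.pi fun _ : Fin p × Grid r => phaseLaw).real
      {θ | u < ‖interference ℓ lam z₀ ((θ, η) : Config p n r) i‖}
      ≤ 4 * Real.exp (-u ^ 2 / (4 * (2 * (r : ℝ) ^ 2 / ((n : ℝ) * p)))) := by
  let b : Grid r → ℂ := fun j =>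
    ∑ l, star (propagator ℓ lam z₀ (η l) i) * propagator ℓ lam z₀ (η l) j
  let a : ({x : Fin p × Grid r // ¬ x.2 ≠ i} → ℝ) → {x : Fin p × Grid r // x.2 ≠ i} → ℂ :=
    fun y x => ((1 / ((n : ℝ) * p) : ℝ) : ℂ)
      * star (Complex.exp (Complex.I * (y ⟨(x.1.1, i), by simp⟩ : ℂ))) * b x.1.2
  have hac : Continuous a := by
    refine continuous_pi fun x => ?_
    fun_prop
  have hn' : (0 : ℝ) < n := by exact_mod_cast hn
  have hp' : (0 : ℝ) < p := by exact_mod_cast hp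
  have hnorm : ∀ y x, ‖a y x‖ ^ 2 = (1 / ((n : ℝ) * p)) ^ 2 * ‖b x.1.2‖ ^ 2 := by
    intro y x
    rw [norm_mul, norm_mul, norm_star, Complex.norm_exp_I_mul_ofReal, Complex.norm_real, mul_one,
      mul_pow, Real.norm_eq_abs, sq_abs]
  have hb : ∑ j, ‖b j‖ ^ 2 ≤ (r : ℝ) ^ 2 * (2 * n) :=
    (sum_norm_sum_star_propagator_sq_le hr hlam hz₀ hrayleigh hη i).trans (by
      gcongr; linarith)
  have ha : ∀ y, ∑ x, ‖a y x‖ ^ 2 ≤ 2 * (r : ℝ) ^ 2 / ((n : ℝ) * p) := by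
    intro y
    simp only [hnorm]
    rw [← Finset.sum_subtype (Finset.univ.filter fun x : Fin p × Grid r => x.2 ≠ i) (by simp)
      fun x : Fin p × Grid r => (1 / ((n : ℝ) * p)) ^ 2 * ‖b x.2‖ ^ 2]
    calc _ ≤ ∑ x : Fin p × Grid r, (1 / ((n : ℝ) * p)) ^ 2 * ‖b x.2‖ ^ 2 :=
          Finset.sum_le_sum_of_subset_of_nonneg (Finset.subset_univ _) fun _ _ _ => by positivity
      _ = p * ((1 / ((n : ℝ) * p)) ^ 2 * ∑ j, ‖b j‖ ^ 2) := by
          rw [Fintype.sum_prod_type]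
          simp only [Finset.sum_const, Finset.card_univ, Fintype.card_fin, nsmul_eq_mul,
            Finset.mul_sum]
      _ ≤ p * ((1 / ((n : ℝ) * p)) ^ 2 * ((r : ℝ) ^ 2 * (2 * n))) := by gcongr
      _ = _ := by field_simp
  have h := measureReal_norm_sum_subtype_mul_exp_gt_le
    (fun x : Fin p × Grid r => x.2 ≠ i) hac ha hu
  have hset : {θ : Fin p × Grid r → ℝ | u < ‖interference ℓ lam z₀ ((θ, η) : Config p n r) i‖}
      = {θ | u < ‖∑ x : {x : Fin p × Grid r // x.2 ≠ i},
        a (fun y => θ y) x * Complex.exp (Complex.I * (θ x : ℂ))‖} := by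
    ext θ
    simp only [Set.mem_ofPred_eq, interference_eq_sum, a, b]
  rw [hset]
  exact h

theorem isProbabilityMeasure_configLaw (hr : 0 < r) :
    IsProbabilityMeasure (configLaw p n r A) := by
  have := isProbabilityMeasure_uniformOn_sensorSet A hr
  have : IsProbabilityMeasure (Measure.pi fun _ : Fin p × Grid r => phaseLaw) := inferInstance
  unfold configLaw
  infer_instance

/-- The average-coherence bound: with high probability all interferences are small. -/
theorem configLaw_exists_lt_norm_interference_le (hn : 0 < n) (hp : 0 < p) (hr : 0 < r)
    (hA : 0 < A) (hlam : 0 < lam) (hz₀ : 0 < z₀) (hrayleigh : A * ℓ / (lam * z₀) = 1)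
    {u : ℝ} (hu : 0 ≤ u) :
    (configLaw p n r A).real {c | ∃ i, u < ‖interference ℓ lam z₀ c i‖}
      ≤ (r : ℝ) ^ 2 * (4 * Real.exp (-u ^ 2 / (4 * (2 * (r : ℝ) ^ 2 / ((n : ℝ) * p)))))
        + n / (r : ℝ) ^ 2 := by
  have := isProbabilityMeasure_uniformOn_sensorSet A hr
  have hT : MeasurableSet {c : Config p n r | ∃ i, u < ‖interference ℓ lam z₀ c i‖} := by
    have : {c : Config p n r | ∃ i, u < ‖interference ℓ lam z₀ c i‖}
        = ⋃ i, {c | u < ‖interference ℓ lam z₀ c i‖} := by ext; simp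
    rw [this]
    exact MeasurableSet.iUnion fun i =>
      (isOpen_lt continuous_const (continuous_interference i).norm).measurableSet
  refine (measureReal_prod_le_add_of_forall_snd
    (μ := Measure.pi fun _ : Fin p × Grid r => phaseLaw)
    (ν := Measure.pi fun _ : Fin n => sensorLaw A r) hT
    (B := {η | (n : ℝ) ≤ collisions η}) (by positivity) ?_).trans
    (add_le_add_right (measureReal_le_collisions_le hn hA hr) _)
  filter_upwards [ae_pi_sensorLaw_mem hr] with η hη hcoll
  have hcoll : collisions η ≤ n := (not_le.1 hcoll).le
  have hsub : {θ : Fin p × Grid r → ℝ | ((θ, η) : Config p n r) ∈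
      {c : Config p n r | ∃ i, u < ‖interference ℓ lam z₀ c i‖}}
      ⊆ ⋃ i ∈ (Finset.univ : Finset (Grid r)),
        {θ | u < ‖interference ℓ lam z₀ ((θ, η) : Config p n r) i‖} := by
    intro θ hθ
    simpa using hθ
  refine (measureReal_mono hsub (measure_ne_top _ _)).trans
    ((measureReal_biUnion_finset_le _ _).trans ?_)
  refine (Finset.sum_le_sum fun i _ => measureReal_phases_lt_norm_interference_le hn hp hr hlam hz₀
    hrayleigh hη hcoll hu i).trans (le_of_eq ?_)
  simp [sq]

end ColumnSums

/-! ### Parameters for which the success bound is positive -/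

section Parameters

/-- The success bound is positive only in an asymptotic regime: the terms `4 / √n` and `4 / √p` force
`n, p > 16`, the term linear in `t` forces `12 t² ≤ 6/5`, and then the exponential term forces
`√((N - 1) / (np)) ≥ 5/6 log (8N)`. -/
theorem parameters_of_successBound_pos {N n p : ℕ} (hN : 0 < N) (hn : 0 < n) (hp : 0 < p)
    {δ t : ℝ} (hδ : 0 < δ) (ht : 0 < t) (h : 0 < successBound N n p δ t) :
    16 < (n : ℝ) ∧ 16 < (p : ℝ) ∧ 5 ≤ Real.log N ∧ 34 * ((n : ℝ) * p) ≤ N := by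
  have hN' : (1 : ℝ) ≤ N := by exact_mod_cast hN
  have hn' : (0 : ℝ) < n := by exact_mod_cast hn
  have hp' : (0 : ℝ) < p := by exact_mod_cast hp
  unfold successBound at h
  set S := Real.sqrt (((N : ℝ) - 1) / ((n : ℝ) * p)) with hS
  have h1 : 0 < 4 * t * Real.sqrt (2 / Real.pi) := by positivity
  have h2 : 0 < 4 / Real.sqrt p := by positivity
  have h3 : 0 < 4 / Real.sqrt n := by positivity
  have h4 : 0 < 8 * N * Real.exp (-12 * t ^ 2 * S) := by positivity
  have h16 : ∀ x : ℝ, 0 < x → 4 / Real.sqrt x < 1 → 16 < x := by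
    intro x hx hlt
    rw [div_lt_one (by positivity)] at hlt
    have := (Real.lt_sqrt (by norm_num)).1 hlt
    linarith
  have hn16 : 16 < (n : ℝ) := h16 _ hn' (by linarith)
  have hp16 : 16 < (p : ℝ) := h16 _ hp' (by linarith)
  have ht2 : 12 * t ^ 2 ≤ 6 / 5 := by
    have hlt : 4 * t * Real.sqrt (2 / Real.pi) < 1 := by linarith
    have hsq : (4 * t * Real.sqrt (2 / Real.pi)) ^ 2 < 1 := by
      rw [sq_lt_one_iff_abs_lt_one, abs_of_pos h1]; exact hlt
    rw [mul_pow, Real.sq_sqrt (by positivity), mul_div_assoc', div_lt_one Real.pi_pos] at hsq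
    have := Real.pi_lt_d2
    nlinarith
  have hS0 : 0 ≤ S := Real.sqrt_nonneg _
  have hlog : Real.log (8 * N) ≤ 6 / 5 * S := by
    have hlt : 8 * N * Real.exp (-12 * t ^ 2 * S) < 1 := by linarith
    have hlog := Real.log_lt_log h4 hlt
    rw [Real.log_mul (by positivity) (Real.exp_pos _).ne', Real.log_exp, Real.log_one] at hlog
    have := mul_le_mul_of_nonneg_right ht2 hS0
    linarith
  have he := Real.exp_one_lt_d9
  have hlog8 : 2 ≤ Real.log 8 := by
    rw [Real.le_log_iff_exp_le (by norm_num)]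
    have : Real.exp 2 = Real.exp 1 ^ 2 := by rw [← Real.exp_nat_mul]; norm_num
    rw [this]
    have := pow_le_pow_left₀ (Real.exp_pos 1).le he.le 2
    norm_num at this ⊢
    linarith
  rw [Real.log_mul (by norm_num) (by linarith)] at hlog
  have hnp : 0 < (n : ℝ) * p := by positivity
  have hnp' : 256 ≤ (n : ℝ) * p := by nlinarith
  have hSsq : S ^ 2 * ((n : ℝ) * p) = N - 1 := by
    rw [hS, Real.sq_sqrt (div_nonneg (by linarith) hnp.le), div_mul_cancel₀ _ hnp.ne']
  have hL0 : 0 ≤ Real.log N := Real.log_nonneg hN'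
  have hL5 : 5 ≤ Real.log N := by
    -- `log 8 ≥ 2` already gives `S ≥ 1`, so `N ≥ 256 > exp 5`.
    have hS1 : 1 ≤ S := by linarith
    have : (256 : ℝ) ≤ N := by nlinarith
    rw [Real.le_log_iff_exp_le (by linarith)]
    have h5 : Real.exp 5 = Real.exp 1 ^ 5 := by rw [← Real.exp_nat_mul]; norm_num
    rw [h5]
    have := pow_le_pow_left₀ (Real.exp_pos 1).le he.le 5
    norm_num at this ⊢
    linarith
  refine ⟨hn16, hp16, hL5, ?_⟩
  -- `log (8 N) ≥ 2 + 5`, and `(35 / 6)² ≥ 34`.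
  have hS2 : 35 / 6 ≤ S := by linarith
  have hS3 : 34 ≤ S ^ 2 := by nlinarith
  nlinarith

theorem failure_le_of_parameters {N n p : ℕ} {δ t : ℝ} (hδ : 0 < δ) (ht : 0 < t)
    (hn : 16 < (n : ℝ)) (hp : 16 < (p : ℝ)) (hN : 34 * ((n : ℝ) * p) ≤ N) :
    12 / (N : ℝ) + n / (N : ℝ) ≤ 1 - successBound N n p δ t := by
  have h1 : 0 ≤ 4 * t * Real.sqrt (2 / Real.pi) := by positivity
  have h2 : 0 ≤ 8 * N * Real.exp (-12 * t ^ 2 * Real.sqrt (((N : ℝ) - 1) / ((n : ℝ) * p))) := by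
    positivity
  have hsqrt : ∀ x : ℝ, 16 < x → 1 / x ≤ 4 / Real.sqrt x := by
    intro x hx
    have hx0 : 0 < Real.sqrt x := Real.sqrt_pos.2 (by linarith)
    have : Real.sqrt x ≤ x := by
      rw [Real.sqrt_le_left (by linarith)]; nlinarith
    gcongr
    norm_num
  have hN0 : 0 < (N : ℝ) := by nlinarith
  have h3 : 12 / (N : ℝ) ≤ 1 / n := by
    rw [div_le_div_iff₀ hN0 (by linarith)]; nlinarith
  have h4 : (n : ℝ) / N ≤ 1 / p := by
    rw [div_le_div_iff₀ hN0 (by linarith)]; nlinarith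
  have := hsqrt n hn
  have := hsqrt p hp
  unfold successBound
  linarith

end Parameters

/-! ### One-Step Thresholding for the sensing matrix -/

section Localization

variable {p n r : ℕ} {ℓ lam z₀ A : ℝ}

theorem sum_sq_eq_one_of_norm_toLp {ι : Type*} [Fintype ι] {x : ι → ℝ}
    (h : ‖WithLp.toLp 2 x‖ = 1) : ∑ j, x j ^ 2 = 1 := by
  have := EuclideanSpace.real_norm_sq_eq (WithLp.toLp 2 x)
  rw [h, one_pow] at this
  exact this.symm

/-- For every realization of the sensing matrix with small interferences, the Welch bound makes the
worst-case coherence dominate the mean interference of a generic object. -/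
theorem measureReal_exists_lt_norm_matchedFilter_sub_le_of_interference (hn : 0 < n) (hp : 0 < p)
    {N : ℕ} (hN : N = r ^ 2) (hL : 5 ≤ Real.log N) (hNm : 34 * ((n : ℝ) * p) ≤ N)
    {c : Config p n r}
    (hc : ∀ i, ‖interference ℓ lam z₀ c i‖ ≤ N * Real.log N / ((n : ℝ) * p))
    {s : ℕ} (hs : (s : ℝ) ≤ (n : ℝ) * p / (2 * Real.log N)) {σ : ℝ} (hσ : 0 ≤ σ)
    {P : Measure (Grid r → ℝ)} [IsProbabilityMeasure P] (hP : IsGenericSparse s P)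
    (hnorm : ∀ᵐ x ∂P, ‖WithLp.toLp 2 x‖ = 1) :
    (P.prod (complexGaussianNoise (Fin p × Fin n) σ)).real
      {xe | ∃ i, ostThreshold (sensingMatrix ℓ lam z₀ c) σ <
        ‖((sensingMatrix ℓ lam z₀ c)ᴴ *ᵥ noisyData (sensingMatrix ℓ lam z₀ c) xe.1 xe.2) i
          - xe.1 i‖} ≤ 8 / N := by
  set Φ := sensingMatrix ℓ lam z₀ c with hΦ
  set L := Real.log N with hLdef
  set m : ℝ := (n : ℝ) * p with hm
  set μ := worstCaseCoherence Φ with hμ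
  have hn' : (1 : ℝ) ≤ n := by exact_mod_cast hn
  have hp' : (1 : ℝ) ≤ p := by exact_mod_cast hp
  have hm1 : 1 ≤ m := by nlinarith
  have hNpos : (34 : ℝ) ≤ N := by linarith
  have hcard : Fintype.card (Grid r) = N := by simp [hN, sq]
  have hcardκ : (Fintype.card (Fin p × Fin n) : ℝ) = m := by simp [hm, mul_comm]
  have hcol : ∀ i, ∑ a, ‖Φ a i‖ ^ 2 = 1 := sum_norm_sensingMatrix_sq hn hp c
  have : Nonempty (Fin p × Fin n) := ⟨⟨⟨0, hp⟩, ⟨0, hn⟩⟩⟩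
  have hμ2 : 1 / (2 * m) ≤ μ ^ 2 := by
    have h := welch_bound (Φ := Φ) fun a j => by
      rw [hcardκ]; exact norm_sensingMatrix_apply_sq c a j
    rw [hcardκ, hcard] at h
    have h1 : (N : ℝ) - m ≤ m * ((N - 1) * μ ^ 2) := by
      refine le_of_mul_le_mul_left ?_ (by linarith : (0 : ℝ) < N)
      linarith
    rw [div_le_iff₀ (by linarith)]
    nlinarith
  have hμ0 : 0 < μ := by
    refine lt_of_le_of_ne (worstCaseCoherence_nonneg Φ) fun h => ?_
    have : 0 < 1 / (2 * m) := by positivity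
    rw [← h, zero_pow two_ne_zero] at hμ2
    linarith
  have hsm : (s : ℝ) * (2 * L) ≤ m := (le_div_iff₀ (by linarith)).1 hs
  have hs0 : (0 : ℝ) ≤ s := Nat.cast_nonneg s
  have h2s : 2 * s ≤ N := by
    have : 2 * (s : ℝ) ≤ N := by nlinarith
    exact_mod_cast this
  have hmean : ∀ i, Real.sqrt s * ‖∑ j, if j = i then 0 else (Φᴴ * Φ) i j‖
      / (Fintype.card (Grid r) : ℝ) ≤ μ * Real.sqrt (Real.log (Fintype.card (Grid r))) := by
    intro i
    rw [hcard]
    have h1 : ‖∑ j, if j = i then 0 else (Φᴴ * Φ) i j‖ ≤ N * L / m := hc i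
    calc Real.sqrt s * ‖∑ j, if j = i then 0 else (Φᴴ * Φ) i j‖ / (N : ℝ)
        ≤ Real.sqrt s * (N * L / m) / N := by gcongr
      _ = Real.sqrt s * (L / m) := by field_simp
      _ ≤ μ * Real.sqrt L := by
        refine (pow_le_pow_iff_left₀ (by positivity) (by positivity) two_ne_zero).1 ?_
        rw [mul_pow, mul_pow, Real.sq_sqrt hs0, Real.sq_sqrt (by linarith)]
        calc (s : ℝ) * (L / m) ^ 2 = (s * (2 * L)) * (L / (2 * m ^ 2)) := by field_simp
          _ ≤ m * (L / (2 * m ^ 2)) := by gcongr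
          _ = 1 / (2 * m) * L := by field_simp
          _ ≤ μ ^ 2 * L := by gcongr
  have h := measureReal_exists_lt_norm_matchedFilter_sub_le hcol hμ0
    (by rw [hcard]; have : (2 : ℝ) ≤ N := by linarith
        exact_mod_cast this) (by rw [hcard]; exact h2s) hmean hσ hP
    (hnorm.mono fun x hx => sum_sq_eq_one_of_norm_toLp hx)
  rwa [hcard] at h

theorem measurable_ostThreshold_sensingMatrix (σ : ℝ) :
    Measurable fun c : Config p n r => ostThreshold (sensingMatrix ℓ lam z₀ c) σ := by
  have hcol : ∀ j, Continuous fun c : Config p n r => column (sensingMatrix ℓ lam z₀ c) j :=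
    fun j => (PiLp.continuous_toLp 2 _).comp
      (continuous_pi fun a => continuous_sensingMatrix_apply a j)
  have hμ : Measurable fun c : Config p n r => worstCaseCoherence (sensingMatrix ℓ lam z₀ c) := by
    refine Measurable.iSup fun q => ?_
    exact ((hcol _).inner (hcol _)).norm.measurable.div
      ((hcol _).norm.mul (hcol _).norm).measurable
  unfold ostThreshold
  fun_prop

theorem measurableSet_exists_lt_norm_matchedFilter_sub (σ : ℝ) :
    MeasurableSet {w : Config p n r × (Grid r → ℝ) × (Fin p × Fin n → ℂ) |
      ∃ i, ostThreshold (sensingMatrix ℓ lam z₀ w.1) σ <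
        ‖((sensingMatrix ℓ lam z₀ w.1)ᴴ *ᵥ noisyData (sensingMatrix ℓ lam z₀ w.1) w.2.1 w.2.2) i
          - w.2.1 i‖} := by
  have hΦ : ∀ a j, Continuous fun w : Config p n r × (Grid r → ℝ) × (Fin p × Fin n → ℂ) =>
      sensingMatrix ℓ lam z₀ w.1 a j := fun a j =>
    (continuous_sensingMatrix_apply a j).comp continuous_fst
  have hZ : ∀ i, Continuous fun w : Config p n r × (Grid r → ℝ) × (Fin p × Fin n → ℂ) =>
      ((sensingMatrix ℓ lam z₀ w.1)ᴴ *ᵥ noisyData (sensingMatrix ℓ lam z₀ w.1) w.2.1 w.2.2) i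
          - w.2.1 i := by
    intro i
    simp only [Matrix.mulVec, dotProduct, noisyData, Pi.add_apply, Matrix.conjTranspose_apply]
    fun_prop
  have hset : {w : Config p n r × (Grid r → ℝ) × (Fin p × Fin n → ℂ) |
      ∃ i, ostThreshold (sensingMatrix ℓ lam z₀ w.1) σ <
        ‖((sensingMatrix ℓ lam z₀ w.1)ᴴ *ᵥ noisyData (sensingMatrix ℓ lam z₀ w.1) w.2.1 w.2.2) i
          - w.2.1 i‖}
      = ⋃ i, {w | ostThreshold (sensingMatrix ℓ lam z₀ w.1) σ <
        ‖((sensingMatrix ℓ lam z₀ w.1)ᴴ *ᵥ noisyData (sensingMatrix ℓ lam z₀ w.1) w.2.1 w.2.2) i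
          - w.2.1 i‖} := by ext; simp
  rw [hset]
  exact MeasurableSet.iUnion fun i => measurableSet_lt
    ((measurable_ostThreshold_sensingMatrix σ).comp measurable_fst) (hZ i).norm.measurable

end Localization

theorem theorem1 (N r n p : ℕ) (hr : 0 < r) (hN : N = r ^ 2) (hn : 0 < n) (hp : 0 < p)
    (A ℓ lam z₀ : ℝ) (hA : 0 < A) (hℓ : 0 < ℓ) (hlam : 0 < lam) (hz₀ : 0 < z₀)
    (δ K : ℝ) (hδ : 0 < δ) (hK : 0 < K)
    (hmesh : (N : ℝ) ^ 2 ≤ δ / 2 * Real.exp (K ^ 2 / 2))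
    (hdata : (n : ℝ) * p ≥ 40 * K ^ 4 * Real.log N)
    (hrayleigh : A * ℓ / (lam * z₀) = 1)
    (t : ℝ) (ht : 0 < t) :
    -- An event for the sensing matrix on which OST succeeds for all generic sparse objects
    (∃ G : Set (Config p n r), MeasurableSet G ∧
      successBound N n p δ t ≤ (configLaw p n r A).real G ∧
      ∀ c ∈ G, ∀ (s : ℕ) (σ : ℝ), 0 ≤ σ → (s : ℝ) ≤ (n : ℝ) * p / (2 * Real.log N) →
        ∀ (P : Measure (Grid r → ℝ)) [IsProbabilityMeasure P], IsGenericSparse s P →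
        (∀ᵐ x ∂P, ‖WithLp.toLp 2 x‖ = 1) →
        (∀ᵐ x ∂P, 2 * ostThreshold (sensingMatrix ℓ lam z₀ c) σ < minStrength x) →
        (P.prod (complexGaussianNoise (Fin p × Fin n) σ)).real
          {xe | ¬ OSTLocalizes (sensingMatrix ℓ lam z₀ c) σ xe.1 xe.2} ≤ 9 / N) ∧
    -- Success probability over matrix, object and noise together
    (∀ (s : ℕ) (σ : ℝ), 0 ≤ σ → (s : ℝ) ≤ (n : ℝ) * p / (2 * Real.log N) →
      ∀ (P : Measure (Grid r → ℝ)) [IsProbabilityMeasure P], IsGenericSparse s P →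
      (∀ᵐ x ∂P, ‖WithLp.toLp 2 x‖ = 1) →
      successBound N n p δ t ≤
        ((configLaw p n r A).prod (P.prod (complexGaussianNoise (Fin p × Fin n) σ))).real
          {w | 2 * ostThreshold (sensingMatrix ℓ lam z₀ w.1) σ < minStrength w.2.1 →
            OSTLocalizes (sensingMatrix ℓ lam z₀ w.1) σ w.2.1 w.2.2}) := by
  -- The empty event will do if the success bound is not positive.
  rcases le_or_gt (successBound N n p δ t) 0 with hq | hq
  · exact ⟨⟨∅, MeasurableSet.empty, by simpa using hq, by simp⟩,
      fun s σ _ _ P _ _ _ => hq.trans measureReal_nonneg⟩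
  have hN0 : 0 < N := hN ▸ pow_pos hr 2
  obtain ⟨hn16, hp16, hL, hNm⟩ := parameters_of_successBound_pos hN0 hn hp hδ ht hq
  have hfail := failure_le_of_parameters hδ ht hn16 hp16 hNm
  have hN' : (0 : ℝ) < N := by exact_mod_cast hN0
  have hrN : (r : ℝ) ^ 2 = N := by rw [hN]; push_cast; rfl
  have hm0 : 0 < (n : ℝ) * p := by nlinarith
  have := isProbabilityMeasure_configLaw (p := p) (n := n) (A := A) hr
  set u : ℝ := N * Real.log N / ((n : ℝ) * p) with hu
  have hu0 : 0 ≤ u := by positivity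
  -- The coherence event: all column sums of the Gram matrix are small.
  let G : Set (Config p n r) := {c | ∀ i, ‖interference ℓ lam z₀ c i‖ ≤ u}
  have hGm : MeasurableSet G := by
    have : G = ⋂ i, {c | ‖interference ℓ lam z₀ c i‖ ≤ u} := by ext; simp [G]
    rw [this]
    exact MeasurableSet.iInter fun i =>
      (isClosed_le (continuous_interference i).norm continuous_const).measurableSet
  have hGc : (configLaw p n r A).real Gᶜ ≤ 4 / N + n / N := by
    have hset : Gᶜ = {c | ∃ i, u < ‖interference ℓ lam z₀ c i‖} := by ext; simp [G]
    rw [hset]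
    refine (configLaw_exists_lt_norm_interference_le hn hp hr hA hlam hz₀ hrayleigh hu0).trans ?_
    rw [hrN]
    gcongr
    -- The exponent is `-(N / (np)) L² / 8`, and `N / (np) ≥ 34`, `L ≥ 5`.
    have hexp : -u ^ 2 / (4 * (2 * (N : ℝ) / ((n : ℝ) * p))) ≤ -((2 : ℕ) * Real.log N) := by
      have : -u ^ 2 / (4 * (2 * (N : ℝ) / ((n : ℝ) * p)))
          = -(N / ((n : ℝ) * p) * Real.log N ^ 2 / 8) := by
        rw [hu]; field_simp; norm_num
      rw [this]
      have h34 : 34 ≤ N / ((n : ℝ) * p) := (le_div_iff₀ hm0).2 hNm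
      have : 34 * Real.log N ^ 2 ≤ N / ((n : ℝ) * p) * Real.log N ^ 2 := by gcongr
      push_cast
      nlinarith
    calc (N : ℝ) * (4 * Real.exp (-u ^ 2 / (4 * (2 * (N : ℝ) / ((n : ℝ) * p)))))
        ≤ N * (4 * Real.exp (-((2 : ℕ) * Real.log N))) := by gcongr
      _ = 4 / N := by
        rw [Real.exp_neg, Real.exp_nat_mul, Real.exp_log hN']; field_simp
  refine ⟨⟨G, hGm, ?_, ?_⟩, ?_⟩
  · have h := probReal_add_probReal_compl (μ := configLaw p n r A) hGm
    have : 0 ≤ 8 / (N : ℝ) := by positivity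
    have e : 12 / (N : ℝ) = 8 / N + 4 / N := by ring
    linarith
  · intro c hc s σ hσ hs P _ hP hnorm hmin
    have h := measureReal_exists_lt_norm_matchedFilter_sub_le_of_interference hn hp hN hL hNm hc
      hs hσ hP hnorm
    refine le_trans (ENNReal.toReal_mono (measure_ne_top _ _) (measure_mono_ae ?_))
      (h.trans (by gcongr; norm_num))
    filter_upwards [Measure.quasiMeasurePreserving_fst.ae hmin] with xe hxe
    intro hloc
    by_contra hcon
    refine hloc (ostLocalizes_of_forall_norm_sub_le (fun i => ?_) hxe)
    exact not_lt.1 fun hlt => hcon ⟨i, hlt⟩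
  · intro s σ hσ hs P _ hP hnorm
    have hT := measurableSet_exists_lt_norm_matchedFilter_sub (p := p) (n := n) (r := r)
      (ℓ := ℓ) (lam := lam) (z₀ := z₀) σ
    have h := measureReal_prod_le_add_of_forall_fst (μ := configLaw p n r A)
      (ν := P.prod (complexGaussianNoise (Fin p × Fin n) σ)) hT (B := Gᶜ) (ε := 8 / N)
      (by positivity) (Filter.Eventually.of_forall fun c hc =>
        measureReal_exists_lt_norm_matchedFilter_sub_le_of_interference hn hp hN hL hNm
          (Set.notMem_compl_iff.1 hc) hs hσ hP hnorm)
    have hcompl := probReal_add_probReal_compl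
      (μ := (configLaw p n r A).prod (P.prod (complexGaussianNoise (Fin p × Fin n) σ))) hT
    have e : 12 / (N : ℝ) = 8 / N + 4 / N := by ring
    have hlow := (eq_sub_of_add_eq' hcompl).ge
    refine le_trans (le_trans ?_ hlow) (measureReal_mono fun w hw hmin =>
      ostLocalizes_of_forall_norm_sub_le (fun i => not_lt.1 fun hlt => hw ⟨i, hlt⟩) hmin)
    linarith
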